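/- **Setting.** Let $G$ be a smooth real Lie group (finite dimensional, or more generally modelled on a Banach space $E$) with Lie algebra $\mathfrak g=T_1G$, whose bracket is the one defined by left-invariant vector fields. Let $V$ be a real Banach space (for example a finite-dimensional vector space) with dual $V^*$, and let $(v,g)\mapsto vg$ be a smooth right representation of $G$ on $V$ by bounded operators, i.e. $v(gh)=(vg)h$ and $g\mapsto(v\mapsto vg)$ is smooth into the bounded operators on $V$. For $\xi\in\mathfrak g$ let $v\mapsto v\xi$ be the derivative of $g\mapsto(v\mapsto vg)$ at $1$ in the direction $\xi$. Then $G$ acts on $V^*$ on the right by $\langle ag,v\rangle=\langle a,vg^{-1}\rangle$, and $\mathfrak g$ acts by $\langle a\xi,v\rangle=-\langle a,v\xi\rangle$. Write $\langle \mathrm{ad}^*_\xi\mu,\eta\rangle=\langle\mu,[\xi,\eta]\rangle$ for $\mu\in\mathfrak g^*$, and $\langle w\diamond a,\eta\rangle=-\langle a\eta,w\rangle$ for $a\in V^*$ and $w\in V$, or more generally $w\in V^{**}$. Let $L:TG\times V^*\to\mathbb R$ be smooth and right $G$-invariant, $L(v_gh,ah)=L(v_g,a)$, where $v_gh=T_gR_h\,v_g$.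 Let $l:\mathfrak g\times V^*\to\mathbb R$ be the function with $l(v_gg^{-1},a_0g^{-1})=L(v_g,a_0)$, i.e. $l=L|_{T_1G\times V^*}$. Its partial derivatives are $\delta l/\delta\xi\in\mathfrak g^*$ and $\delta l/\delta a\in V^{**}$ (so $\delta l/\delta a\in V$ if $V$ is finite dimensional). Fix $a_0\in V^*$, put $L_{a_0}(v_g)=L(v_g,a_0)$, let $t_1<t_2$, let $g$ be a curve in $G$ that is smooth on a neighbourhood of $[t_1,t_2]$, and put $$\xi(t)=\dot g(t)g(t)^{-1}\in\mathfrak g,\qquad a(t)=a_0\,g(t)^{-1}\in V^*.$$ **Theorem.** For every $t_0\in[t_1,t_2]$, $a$ is the unique solution on $[t_1,t_2]$ of $\dot a=-a\xi$ with the value $a_0g(t_0)^{-1}$ at $t_0$ (in particular, with $a(0)=a_0$, if $0\in[t_1,t_2]$ and $g(0)=1$). Moreover the following are equivalent. 1. Hamilton's principle $\delta\int_{t_1}^{t_2}L_{a_0}(g,\dot g)\,dt=0$: for each smooth variation $g_\varepsilon$ of $g$ on $[t_1,t_2]$, with $g_0=g$, $g_\varepsilon(t_1)=g(t_1)$ and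 $g_\varepsilon(t_2)=g(t_2)$, one has $\frac{d}{d\varepsilon}\big|_{\varepsilon=0}\int_{t_1}^{t_2}L_{a_0}(g_\varepsilon,\dot g_\varepsilon)\,dt=0$. 2. On $[t_1,t_2]$, $g$ satisfies the Euler–Lagrange equations $\frac{d}{dt}\frac{\partial L_{a_0}}{\partial\dot q}=\frac{\partial L_{a_0}}{\partial q}$ in every smooth chart $q$ of $G$. 3. The constrained principle $\delta\int_{t_1}^{t_2}l(\xi,a)\,dt=0$: for each smooth $\eta:[t_1,t_2]\to\mathfrak g$ with $\eta(t_1)=\eta(t_2)=0$ and all smooth families $\xi_\varepsilon,a_\varepsilon$ of curves with $\xi_\varepsilon|_{\varepsilon=0}=\xi$, $a_\varepsilon|_{\varepsilon=0}=a$ whose $\varepsilon$-derivatives at $\varepsilon=0$ are $$\delta\xi=\dot\eta-[\xi,\eta],\qquad\delta a=-a\eta,$$ one has $\frac{d}{d\varepsilon}\big|_{\varepsilon=0}\int_{t_1}^{t_2}l(\xi_\varepsilon,a_\varepsilon)\,dt=0$. 4. The Euler–Poincaré equations hold on $[t_1,t_2]$: $$\frac{d}{dt}\frac{\delta l}{\delta\xi}=-\mathrm{ad}^*_\xi\frac{\delta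 l}{\delta\xi}+\frac{\delta l}{\delta a}\diamond a .$$ -/

import Mathlib

open scoped Manifold ContDiff Topology

noncomputable section

namespace EulerPoincare

/-! Throughout, `G` is a smooth (Banach) Lie group modelled on `E`.  In Mathlib the tangent space
`TangentSpace 𝓘(ℝ, E) x` at any point `x` is a copy of `E` (through the preferred chart at `x`), so
the Lie algebra `𝔤 = T₁G = GroupLieAlgebra 𝓘(ℝ, E) G` is a copy of `E`, and we write elements of
`𝔤` and of `𝔤*` as elements of `E` and `StrongDual ℝ E`. -/

variable {E : Type*} [NormedAddCommGroup E] [NormedSpace ℝ E]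
variable {G : Type*} [TopologicalSpace G] [ChartedSpace E G] [Group G]
variable {V : Type*} [NormedAddCommGroup V] [NormedSpace ℝ V]

section LieGroup

/-- The bracket `[ξ, η]` of the Lie algebra `𝔤 = T₁G` (from left-invariant vector fields). -/
def bracket (G : Type*) [TopologicalSpace G] [ChartedSpace E G] [Group G] (ξ η : E) : E :=
  let x : GroupLieAlgebra 𝓘(ℝ, E) G := ξ
  let y : GroupLieAlgebra 𝓘(ℝ, E) G := η
  let z : GroupLieAlgebra 𝓘(ℝ, E) G := ⁅x, y⁆
  z

/-- The coadjoint operator `ad*_ξ μ`, the dual map of `ad_ξ`: `⟨ad*_ξ μ, η⟩ = ⟨μ, [ξ, η]⟩`. -/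
def adStar (G : Type*) [TopologicalSpace G] [ChartedSpace E G] [Group G]
    (ξ : E) (μ : StrongDual ℝ E) : E → ℝ :=
  fun η => μ (bracket G ξ η)

/-- The velocity `ċ(t) ∈ T_{c(t)} G` of a curve `c`. -/
def velocity (c : ℝ → G) (t : ℝ) : TangentSpace 𝓘(ℝ, E) (c t) :=
  mfderiv 𝓘(ℝ, ℝ) 𝓘(ℝ, E) c t (1 : ℝ)

/-- The curve `(c(t), ċ(t))` in `TG`. -/
def curveLift (c : ℝ → G) (t : ℝ) : TangentBundle 𝓘(ℝ, E) G :=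
  ⟨c t, velocity c t⟩

/-- The tangent lift of right translation, `v_g ↦ v_g h`, from `T_g G` to `T_{gh} G`. -/
def rightTranslate (g : G) (v : TangentSpace 𝓘(ℝ, E) g) (h : G) :
    TangentSpace 𝓘(ℝ, E) (g * h) :=
  mfderiv 𝓘(ℝ, E) 𝓘(ℝ, E) (fun x : G => x * h) g v

/-- `v_g g⁻¹ ∈ 𝔤` for `v_g ∈ T_g G`. -/
def rightTriv (g : G) (v : TangentSpace 𝓘(ℝ, E) g) : E :=
  rightTranslate g v g⁻¹

/-- `ξ(t) = ġ(t) g(t)⁻¹`. -/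
def rightVelocity (g : ℝ → G) (t : ℝ) : E :=
  rightTriv (g t) (velocity g t)

end LieGroup

section Representation

/-! A right representation of `G` on `V` is a monoid homomorphism `ρ` from the opposite group of `G`
to the continuous linear maps of `V`, with `v g = ρ (op g) v`. -/

variable (ρ : Gᵐᵒᵖ →* (V →L[ℝ] V))

/-- The right action of `G` on `V*`, `a g = (the inverse of the dual map of g) a`:
`⟨a g, v⟩ = ⟨a, v g⁻¹⟩`. -/
def dualAct (a : StrongDual ℝ V) (g : G) : StrongDual ℝ V :=
  a.comp (ρ (MulOpposite.op g⁻¹))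

/-- The induced action of `𝔤` on `V`: `v ξ` is the derivative of `g ↦ v g` at the identity in the
direction `ξ`; `infAct ρ ξ` is the operator `v ↦ v ξ`. -/
def infAct (ξ : E) : V →L[ℝ] V :=
  mfderiv 𝓘(ℝ, E) 𝓘(ℝ, V →L[ℝ] V) (fun g : G => ρ (MulOpposite.op g)) (1 : G) ξ

/-- The action of `𝔤` on `V*`, minus the dual of the action on `V`: `⟨a ξ, v⟩ = -⟨a, v ξ⟩`. -/
def dualInfAct (a : StrongDual ℝ V) (ξ : E) : StrongDual ℝ V :=
  -(a.comp (infAct ρ ξ))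

/-- `v ⋄ a ∈ 𝔤*`, characterized by `⟨a η, v⟩ = -⟨v ⋄ a, η⟩`, for `a ∈ V*`.  The first argument is
taken in the bidual `V**`, which contains `V` and is equal to it when `V` is finite dimensional
(or reflexive); on `V` it is the dual map of `η ↦ v η` (see `diamond_inclusion`). -/
def diamond (v : StrongDual ℝ (StrongDual ℝ V)) (a : StrongDual ℝ V) : E → ℝ :=
  fun η => -(v (dualInfAct ρ a η))

theorem diamond_inclusion (v : V) (a : StrongDual ℝ V) (η : E) :
    diamond ρ (NormedSpace.inclusionInDoubleDual ℝ V v) a η = a (infAct ρ η v) := by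
  simp [diamond, dualInfAct]

/-- The advected curve `a(t) = a₀ g(t)⁻¹`. -/
def advected (a₀ : StrongDual ℝ V) (g : ℝ → G) (t : ℝ) : StrongDual ℝ V :=
  dualAct ρ a₀ (g t)⁻¹

end Representation

section Lagrangian

/-- Right `G`-invariance of `L : TG × V* → ℝ` under `(v_g, a) h = (v_g h, a h)`. -/
def RightInvariant (ρ : Gᵐᵒᵖ →* (V →L[ℝ] V))
    (L : TangentBundle 𝓘(ℝ, E) G × StrongDual ℝ V → ℝ) : Prop :=
  ∀ (g : G) (v : TangentSpace 𝓘(ℝ, E) g) (a : StrongDual ℝ V) (h : G),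
    L (⟨g * h, rightTranslate g v h⟩, dualAct ρ a h) = L (⟨g, v⟩, a)

/-- The reduced Lagrangian `l : 𝔤 × V* → ℝ`, the restriction of `L` to `T₁G × V*`.  For a right
invariant `L` it is the function with `l(v_g g⁻¹, a₀ g⁻¹) = L(v_g, a₀)`, see
`reduced_rightTriv`. -/
def reduced (L : TangentBundle 𝓘(ℝ, E) G × StrongDual ℝ V → ℝ) (ξ : E) (a : StrongDual ℝ V) : ℝ :=
  L (⟨(1 : G), ξ⟩, a)

theorem reduced_rightTriv (ρ : Gᵐᵒᵖ →* (V →L[ℝ] V))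
    (L : TangentBundle 𝓘(ℝ, E) G × StrongDual ℝ V → ℝ) (hL : RightInvariant ρ L)
    (g : G) (v : TangentSpace 𝓘(ℝ, E) g) (a₀ : StrongDual ℝ V) :
    reduced L (rightTriv g v) (dualAct ρ a₀ g⁻¹) = L (⟨g, v⟩, a₀) := by
  have key : ∀ (x : G) (w : E), x = 1 → ((⟨x, w⟩ : TangentBundle 𝓘(ℝ, E) G)) = ⟨1, w⟩ := by
    rintro x w rfl
    rfl
  rw [← hL g v a₀ g⁻¹]
  exact congrArg (fun w => L (w, dualAct ρ a₀ g⁻¹))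
    (key (g * g⁻¹) (rightTriv g v) (mul_inv_cancel g)).symm

/-- The functional derivative `δl/δξ (ξ, a) ∈ 𝔤*`. -/
def dXi (l : E → StrongDual ℝ V → ℝ) (ξ : E) (a : StrongDual ℝ V) : StrongDual ℝ E :=
  fderiv ℝ (fun ζ => l ζ a) ξ

/-- The functional derivative `δl/δa (ξ, a)`, an element of `V** ⊇ V`. -/
def dA (l : E → StrongDual ℝ V → ℝ) (ξ : E) (a : StrongDual ℝ V) :
    StrongDual ℝ (StrongDual ℝ V) :=
  fderiv ℝ (fun b => l ξ b) a

end Lagrangian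

section Principles

/-- `Γ(ε, t)` is a smooth variation of the curve `g` on `[t₁, t₂]` with fixed endpoints.
(Smoothness is required at the points of `{0} × [t₁, t₂]`, hence on neighbourhoods of them.) -/
structure IsVariation (g : ℝ → G) (t₁ t₂ : ℝ) (Γ : ℝ → ℝ → G) : Prop where
  smooth : ∀ t ∈ Set.Icc t₁ t₂,
    ContMDiffAt 𝓘(ℝ, ℝ × ℝ) 𝓘(ℝ, E) ∞ (fun p : ℝ × ℝ => Γ p.1 p.2) (0, t)
  base : ∀ t ∈ Set.Icc t₁ t₂, Γ 0 t = g t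
  left : ∀ᶠ ε in 𝓝 (0 : ℝ), Γ ε t₁ = g t₁
  right : ∀ᶠ ε in 𝓝 (0 : ℝ), Γ ε t₂ = g t₂

/-- Hamilton's principle `δ ∫ ℒ(g, ġ) dt = 0` for `ℒ : TG → ℝ` and variations of `g` on `[t₁, t₂]`
with fixed endpoints. -/
def HamiltonPrinciple (ℒ : TangentBundle 𝓘(ℝ, E) G → ℝ) (g : ℝ → G) (t₁ t₂ : ℝ) : Prop :=
  ∀ Γ : ℝ → ℝ → G, IsVariation (E := E) g t₁ t₂ Γ →
    HasDerivAt (fun ε : ℝ => ∫ t in t₁..t₂, ℒ (curveLift (Γ ε) t)) 0 0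

/-- The expression `ℒ_φ(q, u) = ℒ(φ⁻¹(q), D(φ⁻¹)(q) u)` of `ℒ : TG → ℝ` in a chart `φ`. -/
def localLagrangian (ℒ : TangentBundle 𝓘(ℝ, E) G → ℝ) (φ : OpenPartialHomeomorph G E)
    (q u : E) : ℝ :=
  ℒ ⟨φ.symm q, mfderiv 𝓘(ℝ, E) 𝓘(ℝ, E) φ.symm q u⟩

/-- The Euler-Lagrange equations `d/dt ∂ℒ/∂q̇ = ∂ℒ/∂q` along `g` on `[t₁, t₂]`, in every smooth
chart of `G`. -/
def EulerLagrange (ℒ : TangentBundle 𝓘(ℝ, E) G → ℝ) (g : ℝ → G) (t₁ t₂ : ℝ) : Prop :=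
  ∀ φ ∈ IsManifold.maximalAtlas 𝓘(ℝ, E) ∞ G, ∀ t ∈ Set.Icc t₁ t₂, g t ∈ φ.source →
    HasDerivAt
      (fun s => fderiv ℝ (fun u => localLagrangian ℒ φ (φ (g s)) u) (deriv (fun r => φ (g r)) s))
      (fderiv ℝ (fun q => localLagrangian ℒ φ q (deriv (fun r => φ (g r)) t)) (φ (g t))) t

/-- The constrained variational principle `δ ∫ l(ξ, a) dt = 0`: the first variation vanishes for all
smooth families `(Ξ(ε, t), A(ε, t))` through `(ξ, a)` whose variation fields at `ε = 0` are
`δξ = η̇ - [ξ, η]`, `δa = -a η` for a smooth curve `η` in `𝔤` that vanishes at `t₁` and `t₂`. -/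
def ConstrainedPrinciple (ρ : Gᵐᵒᵖ →* (V →L[ℝ] V)) (l : E → StrongDual ℝ V → ℝ)
    (ξ : ℝ → E) (a : ℝ → StrongDual ℝ V) (t₁ t₂ : ℝ) : Prop :=
  ∀ (η : ℝ → E) (Ξ : ℝ → ℝ → E) (A : ℝ → ℝ → StrongDual ℝ V),
    (∀ t ∈ Set.Icc t₁ t₂, ContDiffAt ℝ ∞ η t) → η t₁ = 0 → η t₂ = 0 →
    (∀ t ∈ Set.Icc t₁ t₂, ContDiffAt ℝ ∞ (fun p : ℝ × ℝ => Ξ p.1 p.2) (0, t)) →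
    (∀ t ∈ Set.Icc t₁ t₂, ContDiffAt ℝ ∞ (fun p : ℝ × ℝ => A p.1 p.2) (0, t)) →
    (∀ t ∈ Set.Icc t₁ t₂, Ξ 0 t = ξ t) →
    (∀ t ∈ Set.Icc t₁ t₂, A 0 t = a t) →
    (∀ t ∈ Set.Icc t₁ t₂,
      HasDerivAt (fun ε => Ξ ε t) (deriv η t - bracket G (ξ t) (η t)) 0) →
    (∀ t ∈ Set.Icc t₁ t₂, HasDerivAt (fun ε => A ε t) (-(dualInfAct ρ (a t) (η t))) 0) →
    HasDerivAt (fun ε : ℝ => ∫ t in t₁..t₂, l (Ξ ε t) (A ε t)) 0 0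

/-- The Euler-Poincaré equations `d/dt δl/δξ = -ad*_ξ δl/δξ + δl/δa ⋄ a` in `𝔤*` on `[t₁, t₂]`. -/
def EulerPoincareEquations (ρ : Gᵐᵒᵖ →* (V →L[ℝ] V)) (l : E → StrongDual ℝ V → ℝ)
    (ξ : ℝ → E) (a : ℝ → StrongDual ℝ V) (t₁ t₂ : ℝ) : Prop :=
  ∀ t ∈ Set.Icc t₁ t₂, ∃ μ' : StrongDual ℝ E,
    HasDerivAt (fun s => dXi l (ξ s) (a s)) μ' t ∧
    (μ' : E → ℝ) = -adStar G (ξ t) (dXi l (ξ t) (a t)) + diamond ρ (dA l (ξ t) (a t)) (a t)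

end Principles

end EulerPoincare

end

open EulerPoincare

/-! Conditions 1, 2 and 3 are each compared with 4, which says that `eulerPoincareForm` vanishes on
all of 𝔤 at every time.

In a chart φ let Ω = `chartTriv φ` be the right Maurer–Cartan form and α(q) = a₀ (φ⁻¹ q)⁻¹. By
invariance the Lagrangian in the chart is l(Ω(q) u, α(q)). Two identities remove the chart from its
Euler–Lagrange equations: the Maurer–Cartan equation DΩ(w)u − DΩ(u)w = −[Ωu, Ωw]
(`fderiv_chartTriv_sub`), which rests on the bracket being the antisymmetrized second derivative of
the multiplication (`bracket_eq`), and Dα(w) = −α Ωw (`fderiv_chartAdvected`). The Euler–Lagrange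
expression on w becomes the Euler–Poincaré expression on Ωw, and Ω(q) is onto.

For a family g_ε(t) with η = δg g⁻¹, the same identities and the symmetry of second derivatives give
δξ = η̇ − [ξ, η] and δa = −aη. After an integration by parts the first variation of either action is
−∫ `eulerPoincareForm` (η) dt (`hasDerivAt_integral_constrained`, `hasDerivAt_action`), so 4 implies
1 and 3. Conversely, every field η = f e, with f scalar and e ∈ 𝔤 fixed, comes from an explicit
variation, and the scalar fundamental lemma yields 4.

The advection equation is the formula for Dα taken along g; uniqueness is that of a linear ODE with
continuous coefficients. -/

noncomputable section

namespace EulerPoincare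

open Set Filter

/-! ### The right Maurer–Cartan form in a chart. -/

section RightTrivialization

variable {E : Type*} [NormedAddCommGroup E] [NormedSpace ℝ E]
variable {G : Type*} [TopologicalSpace G] [ChartedSpace E G] [Group G]
variable {F : Type*} [NormedAddCommGroup F] [NormedSpace ℝ F]

/-- A derivative at a point mapped to `1`, read in the preferred chart at `1`. -/
theorem mfderiv_eq_fderiv_chartAt_one {h : F → G} {x : F}
    (hh : MDifferentiableAt 𝓘(ℝ, F) 𝓘(ℝ, E) h x) (hx : h x = 1) (u : F) :
    (mfderiv 𝓘(ℝ, F) 𝓘(ℝ, E) h x u : E) = fderiv ℝ (fun y => chartAt E (1 : G) (h y)) x u := by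
  rw [hh.mfderiv]
  simp only [writtenInExtChartAt, hx]
  simp only [mfld_simps, fderivWithin_univ]
  rfl

/-- The right trivialization of `TG` in a chart `φ`: `u ↦ (D(φ⁻¹)(q) u) (φ⁻¹ q)⁻¹`. -/
def chartTriv (φ : OpenPartialHomeomorph G E) (q : E) : E →L[ℝ] E :=
  fderiv ℝ (fun y => chartAt E (1 : G) (φ.symm y * (φ.symm q)⁻¹)) q

variable [LieGroup 𝓘(ℝ, E) ∞ G]

/-- Chain rule for right translation by `(f x)⁻¹`. The preferred chart at `f x` may jump with `x`;
after translation only the fixed chart at `1` appears, which makes smoothness in `x` accessible. -/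
theorem rightTriv_mfderiv {f : F → G} {x : F}
    (hf : MDifferentiableAt 𝓘(ℝ, F) 𝓘(ℝ, E) f x) (u : F) :
    rightTriv (f x) (mfderiv 𝓘(ℝ, F) 𝓘(ℝ, E) f x u) =
      fderiv ℝ (fun y => chartAt E (1 : G) (f y * (f x)⁻¹)) x u := by
  have hR : MDifferentiableAt 𝓘(ℝ, E) 𝓘(ℝ, E) (fun y : G => y * (f x)⁻¹) (f x) :=
    ((contMDiff_mul_right (I := 𝓘(ℝ, E)) (n := ∞) (a := (f x)⁻¹)).contMDiffAt).mdifferentiableAt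
      (by simp)
  have hcomp : MDifferentiableAt 𝓘(ℝ, F) 𝓘(ℝ, E) (fun y => f y * (f x)⁻¹) x :=
    MDifferentiableAt.comp x hR hf
  rw [← mfderiv_eq_fderiv_chartAt_one hcomp (mul_inv_cancel _)]
  have := mfderiv_comp x hR hf
  exact (congrArg (fun T => T u) this).symm

theorem contDiffAt_chartAt_one_comp {f : F → G} {x : F}
    (hf : ContMDiffAt 𝓘(ℝ, F) 𝓘(ℝ, E) ∞ f x) (hx : f x ∈ (chartAt E (1 : G)).source) :
    ContDiffAt ℝ ∞ (fun y => chartAt E (1 : G) (f y)) x :=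
  ((contMDiffAt_of_mem_maximalAtlas (IsManifold.chart_mem_maximalAtlas (1 : G)) hx).comp x
    hf).contDiffAt

variable {φ : OpenPartialHomeomorph G E}

omit [Group G] [LieGroup 𝓘(ℝ, E) ∞ G] in
theorem contDiffAt_chart_comp (hφ : φ ∈ IsManifold.maximalAtlas 𝓘(ℝ, E) ∞ G) {f : F → G} {x : F}
    (hf : ContMDiffAt 𝓘(ℝ, F) 𝓘(ℝ, E) ∞ f x) (hx : f x ∈ φ.source) :
    ContDiffAt ℝ ∞ (fun y => φ (f y)) x :=
  ((contMDiffAt_of_mem_maximalAtlas hφ hx).comp x hf).contDiffAt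

omit [Group G] [LieGroup 𝓘(ℝ, E) ∞ G] in
theorem contMDiffAt_chart_symm (hφ : φ ∈ IsManifold.maximalAtlas 𝓘(ℝ, E) ∞ G) {q : E}
    (hq : q ∈ φ.target) : ContMDiffAt 𝓘(ℝ, E) 𝓘(ℝ, E) ∞ φ.symm q :=
  contMDiffAt_symm_of_mem_maximalAtlas hφ hq

/-- Joint smoothness in base point and argument is what makes the partial derivative `chartTriv`
smooth in its base point. -/
theorem contDiffAt_chart_div (hφ : φ ∈ IsManifold.maximalAtlas 𝓘(ℝ, E) ∞ G) {q : E}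
    (hq : q ∈ φ.target) :
    ContDiffAt ℝ ∞
      (fun p : E × E => chartAt E (1 : G) (φ.symm p.2 * (φ.symm p.1)⁻¹)) (q, q) := by
  apply contDiffAt_chartAt_one_comp
  · have h1 : ContMDiffAt 𝓘(ℝ, E × E) 𝓘(ℝ, E) ∞ (fun p : E × E => φ.symm p.1) (q, q) :=
      ContMDiffAt.comp (x := ((q, q) : E × E)) (f := fun p : E × E => p.1)
        (contMDiffAt_chart_symm hφ hq) contDiffAt_fst.contMDiffAt
    have h2 : ContMDiffAt 𝓘(ℝ, E × E) 𝓘(ℝ, E) ∞ (fun p : E × E => φ.symm p.2) (q, q) :=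
      ContMDiffAt.comp (x := ((q, q) : E × E)) (f := fun p : E × E => p.2)
        (contMDiffAt_chart_symm hφ hq) contDiffAt_snd.contMDiffAt
    exact h2.mul h1.inv
  · simp

theorem contDiffAt_chartTriv (hφ : φ ∈ IsManifold.maximalAtlas 𝓘(ℝ, E) ∞ G) {q : E}
    (hq : q ∈ φ.target) : ContDiffAt ℝ ∞ (chartTriv φ) q :=
  ContDiffAt.fderiv (f := fun q y => chartAt E (1 : G) (φ.symm y * (φ.symm q)⁻¹)) (g := id)
    (contDiffAt_chart_div hφ hq) contDiffAt_id (by simp)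

theorem hasFDerivAt_chartTriv (hφ : φ ∈ IsManifold.maximalAtlas 𝓘(ℝ, E) ∞ G) {q : E}
    (hq : q ∈ φ.target) :
    HasFDerivAt (fun y => chartAt E (1 : G) (φ.symm y * (φ.symm q)⁻¹)) (chartTriv φ q) q := by
  have h : ContDiffAt ℝ ∞ (fun y => chartAt E (1 : G) (φ.symm y * (φ.symm q)⁻¹)) q :=
    ContDiffAt.comp (g := fun p : E × E => chartAt E (1 : G) (φ.symm p.2 * (φ.symm p.1)⁻¹))
      q (contDiffAt_chart_div hφ hq) (contDiffAt_const.prodMk contDiffAt_id)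
  exact (h.differentiableAt (by simp)).hasFDerivAt

/-- The right trivialization of the derivative of a map into `G`, computed in a chart. -/
theorem rightTriv_mfderiv_eq_chartTriv (hφ : φ ∈ IsManifold.maximalAtlas 𝓘(ℝ, E) ∞ G)
    {f : F → G} {x : F} (hf : MDifferentiableAt 𝓘(ℝ, F) 𝓘(ℝ, E) f x) (hx : f x ∈ φ.source)
    (u : F) :
    rightTriv (f x) (mfderiv 𝓘(ℝ, F) 𝓘(ℝ, E) f x u) =
      chartTriv φ (φ (f x)) (fderiv ℝ (fun y => φ (f y)) x u) := by
  rw [rightTriv_mfderiv hf]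
  have h1 : DifferentiableAt ℝ (fun y => φ (f y)) x :=
    (((contMDiffAt_of_mem_maximalAtlas hφ hx).mdifferentiableAt (by simp)).comp x
      hf).differentiableAt
  have h2 := (hasFDerivAt_chartTriv hφ (φ.map_source hx)).comp x h1.hasFDerivAt
  have h3 : (fun y => chartAt E (1 : G) (f y * (f x)⁻¹)) =ᶠ[𝓝 x]
      (fun y => chartAt E (1 : G) (φ.symm y * (φ.symm (φ (f x)))⁻¹)) ∘ fun y => φ (f y) := by
    filter_upwards [hf.continuousAt (φ.open_source.mem_nhds hx)] with y hy
    simp [φ.left_inv hx, φ.left_inv (show f y ∈ φ.source from hy)]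
  rw [h3.fderiv_eq, h2.fderiv]
  rfl

theorem rightTriv_mfderiv_chart_symm (hφ : φ ∈ IsManifold.maximalAtlas 𝓘(ℝ, E) ∞ G) {q : E}
    (hq : q ∈ φ.target) (u : E) :
    rightTriv (φ.symm q) (mfderiv 𝓘(ℝ, E) 𝓘(ℝ, E) φ.symm q u) = chartTriv φ q u :=
  rightTriv_mfderiv ((contMDiffAt_chart_symm hφ hq).mdifferentiableAt (by simp)) u

theorem rightVelocity_eq_chartTriv (hφ : φ ∈ IsManifold.maximalAtlas 𝓘(ℝ, E) ∞ G)
    {c : ℝ → G} {t : ℝ} (hc : MDifferentiableAt 𝓘(ℝ, ℝ) 𝓘(ℝ, E) c t) (ht : c t ∈ φ.source) :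
    rightVelocity c t = chartTriv φ (φ (c t)) (deriv (fun s => φ (c s)) t) :=
  rightTriv_mfderiv_eq_chartTriv hφ hc ht (1 : ℝ)

end RightTrivialization

/-! ### The bracket from second derivatives of the multiplication, and the Maurer–Cartan equation.
-/

section MaurerCartan

variable {E : Type*} [NormedAddCommGroup E] [NormedSpace ℝ E]
variable {G : Type*} [TopologicalSpace G] [ChartedSpace E G] [Group G]
variable {F : Type*} [NormedAddCommGroup F] [NormedSpace ℝ F]

/-- A derivative at `1`, read in the preferred chart at `1`. -/
theorem mfderiv_one_eq_fderiv {h : G → F} (hh : MDifferentiableAt 𝓘(ℝ, E) 𝓘(ℝ, F) h (1 : G))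
    (u : E) :
    (mfderiv 𝓘(ℝ, E) 𝓘(ℝ, F) h (1 : G) u : F) =
      fderiv ℝ (fun z => h ((chartAt E (1 : G)).symm z)) (chartAt E (1 : G) 1) u := by
  rw [hh.mfderiv]
  simp only [writtenInExtChartAt]
  simp only [mfld_simps, fderivWithin_univ]
  rfl

variable (E G) in
/-- The multiplication of `G` in the preferred chart at `1`. -/
def chartMul (p : E × E) : E :=
  chartAt E (1 : G) ((chartAt E (1 : G)).symm p.1 * (chartAt E (1 : G)).symm p.2)

variable (E G) in
/-- The second derivative at the identity of the multiplication in the preferred chart at `1`. -/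
def chartMulSnd : E × E →L[ℝ] E × E →L[ℝ] E :=
  fderiv ℝ (fderiv ℝ (chartMul E G)) (chartAt E (1 : G) 1, chartAt E (1 : G) 1)

omit [NormedSpace ℝ E] in
theorem chartAt_symm_chartAt_one : (chartAt E (1 : G)).symm (chartAt E (1 : G) 1) = 1 :=
  (chartAt E (1 : G)).left_inv (mem_chart_source E 1)

variable [LieGroup 𝓘(ℝ, E) ∞ G]

theorem contDiffAt_chartMul {y z : E} (hy : y ∈ (chartAt E (1 : G)).target)
    (hz : z ∈ (chartAt E (1 : G)).target)
    (hyz : (chartAt E (1 : G)).symm y * (chartAt E (1 : G)).symm z ∈ (chartAt E (1 : G)).source) :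
    ContDiffAt ℝ ∞ (chartMul E G) (y, z) := by
  have hψ := IsManifold.chart_mem_maximalAtlas (I := 𝓘(ℝ, E)) (n := ∞) (1 : G)
  refine contDiffAt_chartAt_one_comp (F := E × E) (x := (y, z)) (f := fun p : E × E =>
    (chartAt E (1 : G)).symm p.1 * (chartAt E (1 : G)).symm p.2) ?_ hyz
  have h1 : ContMDiffAt 𝓘(ℝ, E × E) 𝓘(ℝ, E) ∞
      (fun p : E × E => (chartAt E (1 : G)).symm p.1) (y, z) :=
    ContMDiffAt.comp (x := ((y, z) : E × E)) (f := fun p : E × E => p.1)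
      (contMDiffAt_chart_symm hψ hy) contDiffAt_fst.contMDiffAt
  have h2 : ContMDiffAt 𝓘(ℝ, E × E) 𝓘(ℝ, E) ∞
      (fun p : E × E => (chartAt E (1 : G)).symm p.2) (y, z) :=
    ContMDiffAt.comp (x := ((y, z) : E × E)) (f := fun p : E × E => p.2)
      (contMDiffAt_chart_symm hψ hz) contDiffAt_snd.contMDiffAt
  exact h1.mul h2

theorem contDiffAt_chartMul_one_left {z : E} (hz : z ∈ (chartAt E (1 : G)).target) :
    ContDiffAt ℝ ∞ (chartMul E G) (chartAt E (1 : G) 1, z) :=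
  contDiffAt_chartMul (mem_chart_target E 1) hz
    (by simpa [chartAt_symm_chartAt_one] using (chartAt E (1 : G)).map_target hz)

theorem contDiffAt_chartMul_one_right {y : E} (hy : y ∈ (chartAt E (1 : G)).target) :
    ContDiffAt ℝ ∞ (chartMul E G) (y, chartAt E (1 : G) 1) :=
  contDiffAt_chartMul hy (mem_chart_target E 1)
    (by simpa [chartAt_symm_chartAt_one] using (chartAt E (1 : G)).map_target hy)

theorem hasFDerivAt_fderiv_chartMul :
    HasFDerivAt (fderiv ℝ (chartMul E G)) (chartMulSnd E G)
      (chartAt E (1 : G) 1, chartAt E (1 : G) 1) := by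
  have h : ContDiffAt ℝ ∞ (fderiv ℝ (chartMul E G)) (chartAt E (1 : G) 1, chartAt E (1 : G) 1) :=
    (contDiffAt_chartMul_one_left (mem_chart_target E 1)).fderiv_right (by simp)
  exact (h.differentiableAt (by simp)).hasFDerivAt

theorem chartMulSnd_symm (v w : E × E) : chartMulSnd E G v w = chartMulSnd E G w v :=
  (contDiffAt_chartMul_one_left (G := G) (mem_chart_target E 1)).isSymmSndFDerivAt
    (by simpa using ENat.LEInfty.out) v w

theorem fderiv_chartMul_left (u : E) :
    fderiv ℝ (chartMul E G) (chartAt E (1 : G) 1, chartAt E (1 : G) 1) (u, 0) = u := by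
  have h := HasFDerivAt.comp (f := fun y => (y, chartAt E (1 : G) 1)) (chartAt E (1 : G) 1)
    ((contDiffAt_chartMul_one_left (G := G) (mem_chart_target E 1)).differentiableAt
      (by simp)).hasFDerivAt
    (hasFDerivAt_prodMk_left (𝕜 := ℝ) (chartAt E (1 : G) 1) (chartAt E (1 : G) 1))
  have h2 : (chartMul E G ∘ fun y => (y, chartAt E (1 : G) 1)) =ᶠ[𝓝 (chartAt E (1 : G) 1)] id := by
    filter_upwards [(chartAt E (1 : G)).open_target.mem_nhds (mem_chart_target E 1)] with y hy
    simp [chartMul, (chartAt E (1 : G)).right_inv hy]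
  have h3 := (h.congr_of_eventuallyEq h2.symm).unique (hasFDerivAt_id _)
  simpa using congrArg (fun T => T u) h3

theorem fderiv_chartMul_right (u : E) :
    fderiv ℝ (chartMul E G) (chartAt E (1 : G) 1, chartAt E (1 : G) 1) (0, u) = u := by
  have h := ((contDiffAt_chartMul_one_left (G := G) (mem_chart_target E 1)).differentiableAt
    (by simp)).hasFDerivAt.comp (chartAt E (1 : G) 1)
    (hasFDerivAt_prodMk_right (𝕜 := ℝ) (chartAt E (1 : G) 1) (chartAt E (1 : G) 1))
  have h2 : (chartMul E G ∘ fun y => (chartAt E (1 : G) 1, y)) =ᶠ[𝓝 (chartAt E (1 : G) 1)] id := by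
    filter_upwards [(chartAt E (1 : G)).open_target.mem_nhds (mem_chart_target E 1)] with y hy
    simp [chartMul, (chartAt E (1 : G)).right_inv hy]
  have h3 := (h.congr_of_eventuallyEq h2.symm).unique (hasFDerivAt_id _)
  simpa using congrArg (fun T => T u) h3

open VectorField in
/-- A left invariant vector field in the preferred chart at `1`. -/
theorem mpullbackWithin_mulInvariantVectorField (ξ : E) {y : E}
    (hy : y ∈ (chartAt E (1 : G)).target) :
    mpullbackWithin 𝓘(ℝ, E) 𝓘(ℝ, E) (extChartAt 𝓘(ℝ, E) (1 : G)).symm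
      (mulInvariantVectorField (ξ : GroupLieAlgebra 𝓘(ℝ, E) G)) (range 𝓘(ℝ, E)) y =
    fderiv ℝ (chartMul E G) (y, chartAt E (1 : G) 1) (0, ξ) := by
  have hy' : y ∈ (extChartAt 𝓘(ℝ, E) (1 : G)).target := by simpa using hy
  set x := (chartAt E (1 : G)).symm y with hx
  have hxs : x ∈ (chartAt E (1 : G)).source := (chartAt E (1 : G)).map_target hy
  have hinv := ContinuousLinearMap.inverse_eq
    (mfderivWithin_extChartAt_symm_comp_mfderiv_extChartAt hy')
    (mfderiv_extChartAt_comp_mfderivWithin_extChartAt_symm hy')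
  rw [mpullbackWithin_apply, hinv]
  have hL : MDifferentiableAt 𝓘(ℝ, E) 𝓘(ℝ, E) (fun z : G => x * z) 1 :=
    ((contMDiff_mul_left (I := 𝓘(ℝ, E)) (n := ∞) (a := x)).contMDiffAt).mdifferentiableAt (by simp)
  have hc : MDifferentiableAt 𝓘(ℝ, E) 𝓘(ℝ, E) (extChartAt 𝓘(ℝ, E) (1 : G)) (x * 1) :=
    mdifferentiableAt_extChartAt (by simpa using hxs)
  have e1 := mfderiv_comp (1 : G) hc hL
  have e2 := mfderiv_one_eq_fderiv (hc.comp (1 : G) hL) ξ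
  -- `x * 1 = x` is not definitional, but every tangent space is `E`, so derivatives at the two
  -- points can be compared as maps of `E`.
  have e3 : ∀ z : G, z = x * 1 →
      (mfderiv 𝓘(ℝ, E) 𝓘(ℝ, E) (extChartAt 𝓘(ℝ, E) (1 : G)) z : E →L[ℝ] E) =
        (mfderiv 𝓘(ℝ, E) 𝓘(ℝ, E) (extChartAt 𝓘(ℝ, E) (1 : G)) (x * 1) : E →L[ℝ] E) := by
    rintro _ rfl; rfl
  have e4 := ((contDiffAt_chartMul_one_right (G := G) hy).differentiableAt
    (by simp)).hasFDerivAt.comp (chartAt E (1 : G) 1)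
    (hasFDerivAt_prodMk_right (𝕜 := ℝ) y (chartAt E (1 : G) 1))
  have e5 : fderiv ℝ (chartMul E G) (y, chartAt E (1 : G) 1) (0, ξ) =
      fderiv ℝ (chartMul E G ∘ fun z => (y, z)) (chartAt E (1 : G) 1) ξ := by
    rw [e4.fderiv]; simp
  rw [e5]
  refine Eq.trans ?_ e2
  rw [e1]
  exact congrArg (fun T : E →L[ℝ] E =>
    T (mfderiv 𝓘(ℝ, E) 𝓘(ℝ, E) (fun z : G => x * z) 1 ξ)) (e3 x (mul_one x).symm)

open VectorField in
/-- The Lie bracket is the antisymmetrized second derivative of the multiplication in a chart. -/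
theorem bracket_eq (ξ η : E) :
    bracket G ξ η = chartMulSnd E G (ξ, 0) (0, η) - chartMulSnd E G (η, 0) (0, ξ) := by
  have hid : ((mfderiv 𝓘(ℝ, E) 𝓘(ℝ, E) (extChartAt 𝓘(ℝ, E) (1 : G)) (1 : G) : E →L[ℝ] E)) =
      ContinuousLinearMap.id ℝ E := by
    have hm : MDifferentiableAt 𝓘(ℝ, E) 𝓘(ℝ, E) (extChartAt 𝓘(ℝ, E) (1 : G)) (1 : G) :=
      mdifferentiableAt_extChartAt (mem_chart_source E 1)
    ext u
    refine (mfderiv_one_eq_fderiv hm u).trans ?_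
    have h2 : (fun z => extChartAt 𝓘(ℝ, E) (1 : G) ((chartAt E (1 : G)).symm z))
        =ᶠ[𝓝 (chartAt E (1 : G) 1)] id := by
      filter_upwards [(chartAt E (1 : G)).open_target.mem_nhds (mem_chart_target E 1)] with y hy
      simp [(chartAt E (1 : G)).right_inv hy]
    rw [h2.fderiv_eq, fderiv_id]
    rfl
  let X : E → E → E := fun ζ =>
    mpullbackWithin 𝓘(ℝ, E) 𝓘(ℝ, E) (extChartAt 𝓘(ℝ, E) (1 : G)).symm
      (mulInvariantVectorField (ζ : GroupLieAlgebra 𝓘(ℝ, E) G)) (range 𝓘(ℝ, E))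
  have hX : ∀ ζ : E, X ζ =ᶠ[𝓝 (chartAt E (1 : G) 1)]
      fun y => fderiv ℝ (chartMul E G) (y, chartAt E (1 : G) 1) (0, ζ) := by
    intro ζ
    filter_upwards [(chartAt E (1 : G)).open_target.mem_nhds (mem_chart_target E 1)] with y hy
    exact mpullbackWithin_mulInvariantVectorField ζ hy
  have hD : ∀ ζ : E, HasFDerivAt
      (fun y => fderiv ℝ (chartMul E G) (y, chartAt E (1 : G) 1) (0, ζ))
      ((ContinuousLinearMap.apply ℝ E ((0, ζ) : E × E)).comp
        ((chartMulSnd E G).comp (ContinuousLinearMap.inl ℝ E E))) (chartAt E (1 : G) 1) := by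
    intro ζ
    exact (ContinuousLinearMap.apply ℝ E ((0, ζ) : E × E)).hasFDerivAt.comp
      (chartAt E (1 : G) 1) (hasFDerivAt_fderiv_chartMul.comp (chartAt E (1 : G) 1)
        (hasFDerivAt_prodMk_left (𝕜 := ℝ) (chartAt E (1 : G) 1) (chartAt E (1 : G) 1)))
  have hlie : lieBracketWithin ℝ (X ξ) (X η) univ (chartAt E (1 : G) 1) =
      chartMulSnd E G (ξ, 0) (0, η) - chartMulSnd E G (η, 0) (0, ξ) := by
    rw [lieBracketWithin_univ]
    refine (Filter.EventuallyEq.lieBracket_vectorField_eq (hX ξ) (hX η)).trans ?_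
    -- The convention is [X, Y] = DY(X) − DX(Y), and the field of ζ has the value ζ at the identity.
    simp only [lieBracket, (hD ξ).fderiv, (hD η).fderiv, fderiv_chartMul_right]
    rfl
  have hbr : bracket G ξ η =
      (show E →L[ℝ] E from
        mfderiv 𝓘(ℝ, E) 𝓘(ℝ, E) (extChartAt 𝓘(ℝ, E) (1 : G)) (1 : G)).inverse
        (lieBracketWithin ℝ (X ξ) (X η)
          ((extChartAt 𝓘(ℝ, E) (1 : G)).symm ⁻¹' univ ∩ range 𝓘(ℝ, E))
          (extChartAt 𝓘(ℝ, E) (1 : G) 1)) := rfl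
  have hset : (extChartAt 𝓘(ℝ, E) (1 : G)).symm ⁻¹' univ ∩ range 𝓘(ℝ, E) = univ := by simp
  have hpt : extChartAt 𝓘(ℝ, E) (1 : G) 1 = chartAt E (1 : G) 1 := by simp
  rw [hset, hpt, hlie] at hbr
  refine hbr.trans ((congrArg (fun T : E →L[ℝ] E => T.inverse
    (chartMulSnd E G (ξ, 0) (0, η) - chartMulSnd E G (η, 0) (0, ξ))) hid).trans ?_)
  simp

variable (E G) in
/-- The Lie bracket as a continuous bilinear map. -/
def bracketCLM : E →L[ℝ] E →L[ℝ] E :=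
  let B := ((ContinuousLinearMap.compL ℝ E (E × E) E).flip (ContinuousLinearMap.inr ℝ E E)).comp
    ((chartMulSnd E G).comp (ContinuousLinearMap.inl ℝ E E))
  B - B.flip

theorem bracketCLM_apply (ξ η : E) : bracketCLM E G ξ η = bracket G ξ η := by
  rw [bracket_eq]
  simp [bracketCLM]

variable {φ : OpenPartialHomeomorph G E}

theorem contDiffAt_chart_mul_right (hφ : φ ∈ IsManifold.maximalAtlas 𝓘(ℝ, E) ∞ G) {q : E}
    (hq : q ∈ φ.target) {k : G} (hk : φ.symm q * k ∈ (chartAt E (1 : G)).source) :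
    ContDiffAt ℝ ∞ (fun y => chartAt E (1 : G) (φ.symm y * k)) q :=
  contDiffAt_chartAt_one_comp ((contMDiffAt_chart_symm hφ hq).mul contMDiffAt_const) hk

/-- The right trivialization in a chart is inverted by the derivative of the multiplication. -/
theorem fderiv_chartMul_chartTriv (hφ : φ ∈ IsManifold.maximalAtlas 𝓘(ℝ, E) ∞ G) {q : E}
    (hq : q ∈ φ.target) {k : G} (hk : φ.symm q * k ∈ (chartAt E (1 : G)).source) (u : E) :
    fderiv ℝ (chartMul E G) (chartAt E (1 : G) 1, chartAt E (1 : G) (φ.symm q * k))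
        (chartTriv φ q u, 0) =
      fderiv ℝ (fun y => chartAt E (1 : G) (φ.symm y * k)) q u := by
  have h1 := hasFDerivAt_chartTriv hφ hq
  have h2 : HasFDerivAt (chartMul E G)
      (fderiv ℝ (chartMul E G) (chartAt E (1 : G) 1, chartAt E (1 : G) (φ.symm q * k)))
      (chartAt E (1 : G) (φ.symm q * (φ.symm q)⁻¹), chartAt E (1 : G) (φ.symm q * k)) := by
    rw [mul_inv_cancel]
    exact ((contDiffAt_chartMul_one_left ((chartAt E (1 : G)).map_source hk)).differentiableAt
      (by simp)).hasFDerivAt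
  have h3 := HasFDerivAt.comp (f := fun y => (chartAt E (1 : G) (φ.symm y * (φ.symm q)⁻¹),
    chartAt E (1 : G) (φ.symm q * k))) q h2 (h1.prodMk (hasFDerivAt_const _ q))
  have hc : ContinuousAt φ.symm q := φ.continuousAt_symm hq
  -- With x = φ⁻¹ y and x₀ = φ⁻¹ q, this is the factorization x k = (x x₀⁻¹)(x₀ k); only the first
  -- factor depends on y.
  have h4 : (fun y => chartAt E (1 : G) (φ.symm y * k)) =ᶠ[𝓝 q]
      (chartMul E G ∘ fun y => (chartAt E (1 : G) (φ.symm y * (φ.symm q)⁻¹),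
        chartAt E (1 : G) (φ.symm q * k))) := by
    have hc1 : ContinuousAt (fun y => φ.symm y * (φ.symm q)⁻¹) q :=
      (((contMDiffAt_chart_symm hφ hq).mul
        (contMDiffAt_const (c := (φ.symm q)⁻¹))).continuousAt)
    have hs : (chartAt E (1 : G)).source ∈ 𝓝 (φ.symm q * (φ.symm q)⁻¹) := by
      rw [mul_inv_cancel]
      exact (chartAt E (1 : G)).open_source.mem_nhds (mem_chart_source E 1)
    filter_upwards [hc1 hs] with y hy
    have hy' : φ.symm y * (φ.symm q)⁻¹ ∈ (chartAt E (1 : G)).source := hy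
    simp [chartMul, (chartAt E (1 : G)).left_inv hy', (chartAt E (1 : G)).left_inv hk,
      mul_assoc]
  rw [h4.fderiv_eq, h3.fderiv]
  simp

/-- The Maurer-Cartan equation. -/
theorem fderiv_chartTriv_sub (hφ : φ ∈ IsManifold.maximalAtlas 𝓘(ℝ, E) ∞ G) {q : E}
    (hq : q ∈ φ.target) (w u : E) :
    fderiv ℝ (chartTriv φ) q w u - fderiv ℝ (chartTriv φ) q u w =
      -bracket G (chartTriv φ q u) (chartTriv φ q w) := by
  set k := (φ.symm q)⁻¹ with hkdef
  have hk : φ.symm q * k = 1 := mul_inv_cancel _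
  have hks : φ.symm q * k ∈ (chartAt E (1 : G)).source := by
    rw [hk]; exact mem_chart_source E 1
  set τ : E → E := fun y => chartAt E (1 : G) (φ.symm y * k) with hτ
  have hτq : τ q = chartAt E (1 : G) 1 := by simp only [hτ, hk]
  have hτs : ContDiffAt ℝ ∞ τ q := contDiffAt_chart_mul_right hφ hq hks
  have hτ1 : HasFDerivAt τ (chartTriv φ q) q := hasFDerivAt_chartTriv hφ hq
  have hτ2 : HasFDerivAt (fderiv ℝ τ) (fderiv ℝ (fderiv ℝ τ) q) q :=
    ((hτs.fderiv_right (m := ∞) (by simp)).differentiableAt (by simp)).hasFDerivAt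
  have hΩ : HasFDerivAt (chartTriv φ) (fderiv ℝ (chartTriv φ) q) q :=
    ((contDiffAt_chartTriv hφ hq).differentiableAt (by simp)).hasFDerivAt
  -- Differentiate ∂₁m(1, τ y)(Ω(y) u) = Dτ(y) u at q along w, where m is the multiplication and k
  -- stays fixed. The right side becomes D²τ, symmetric in w and u, so antisymmetrizing leaves the
  -- bracket.
  have key : ∀ w u : E, chartMulSnd E G (0, chartTriv φ q w) (chartTriv φ q u, 0) +
      fderiv ℝ (chartTriv φ) q w u = fderiv ℝ (fderiv ℝ τ) q w u := by
    intro w u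
    have hM : HasFDerivAt (fderiv ℝ (chartMul E G)) (chartMulSnd E G)
        (chartAt E (1 : G) 1, τ q) := by
      rw [hτq]; exact hasFDerivAt_fderiv_chartMul
    have hA := HasFDerivAt.comp q hM ((hasFDerivAt_const (chartAt E (1 : G) 1) q).prodMk hτ1)
    have hB : HasFDerivAt (fun y => ((chartTriv φ y u, 0) : E × E))
        (((ContinuousLinearMap.apply ℝ E u).comp (fderiv ℝ (chartTriv φ) q)).prod 0) q :=
      ((ContinuousLinearMap.apply ℝ E u).hasFDerivAt.comp q hΩ).prodMk (hasFDerivAt_const _ q)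
    have hC := hA.clm_apply hB
    have hD := (ContinuousLinearMap.apply ℝ E u).hasFDerivAt.comp q hτ2
    have hev : (fun y => (fderiv ℝ (chartMul E G) ∘ fun y => (chartAt E (1 : G) 1, τ y)) y
        (chartTriv φ y u, 0)) =ᶠ[𝓝 q] (ContinuousLinearMap.apply ℝ E u) ∘ fderiv ℝ τ := by
      have hcont : ContinuousAt (fun y => φ.symm y * k) q :=
        ((contMDiffAt_chart_symm hφ hq).mul (contMDiffAt_const (c := k))).continuousAt
      filter_upwards [φ.open_target.mem_nhds hq,
        hcont ((chartAt E (1 : G)).open_source.mem_nhds hks)] with y hy hyk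
      exact fderiv_chartMul_chartTriv hφ hy hyk u
    have hE := (hC.congr_of_eventuallyEq hev.symm).unique hD
    have hF := congrArg (fun T => T w) hE
    simp only [add_apply, ContinuousLinearMap.comp_apply,
      ContinuousLinearMap.prod_apply, Function.comp_apply, ContinuousLinearMap.flip_apply,
      ContinuousLinearMap.apply_apply, zero_apply, hτq,
      fderiv_chartMul_left] at hF
    rw [← hF]
    abel
  have hsymm : fderiv ℝ (fderiv ℝ τ) q w u = fderiv ℝ (fderiv ℝ τ) q u w :=
    hτs.isSymmSndFDerivAt
    (by simpa using ENat.LEInfty.out) w u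
  have e1 := key w u
  have e2 := key u w
  rw [hsymm, ← e2] at e1
  rw [bracket_eq, chartMulSnd_symm (chartTriv φ q u, 0), chartMulSnd_symm (chartTriv φ q w, 0)]
  rw [← sub_eq_zero]
  refine Eq.trans ?_ (sub_eq_zero.2 e1)
  abel

/-- The map `σ`, the inverse chart at `1` followed by right translation to φ⁻¹ q, has trivialized
derivative the identity, and this derivative factors through `chartTriv φ q`. -/
theorem chartTriv_surjective (hφ : φ ∈ IsManifold.maximalAtlas 𝓘(ℝ, E) ∞ G) {q : E}
    (hq : q ∈ φ.target) : Function.Surjective (chartTriv φ q) := by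
  intro v
  set k := φ.symm q with hk
  have hks : k ∈ φ.source := φ.map_target hq
  have hψ := IsManifold.chart_mem_maximalAtlas (I := 𝓘(ℝ, E)) (n := ∞) (1 : G)
  set σ : E → G := fun y => (chartAt E (1 : G)).symm y * k with hσ
  have hσ1 : σ (chartAt E (1 : G) 1) = k := by simp [hσ]
  have hσs : ContMDiffAt 𝓘(ℝ, E) 𝓘(ℝ, E) ∞ σ (chartAt E (1 : G) 1) :=
    (contMDiffAt_chart_symm hψ (mem_chart_target E 1)).mul contMDiffAt_const
  have hσd : MDifferentiableAt 𝓘(ℝ, E) 𝓘(ℝ, E) σ (chartAt E (1 : G) 1) :=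
    hσs.mdifferentiableAt (by simp)
  have h1 := rightTriv_mfderiv_eq_chartTriv hφ hσd (by rw [hσ1]; exact hks) v
  rw [rightTriv_mfderiv hσd] at h1
  have h2 : (fun y => chartAt E (1 : G) (σ y * (σ (chartAt E (1 : G) 1))⁻¹))
      =ᶠ[𝓝 (chartAt E (1 : G) 1)] id := by
    filter_upwards [(chartAt E (1 : G)).open_target.mem_nhds (mem_chart_target E 1)] with y hy
    rw [hσ1]
    simp [hσ, (chartAt E (1 : G)).right_inv hy]
  rw [h2.fderiv_eq, hσ1, φ.right_inv hq] at h1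
  exact ⟨_, h1.symm.trans (by simp)⟩

end MaurerCartan

/-! ### The derivative of the advected quantity. -/

section Advection

variable {E : Type*} [NormedAddCommGroup E] [NormedSpace ℝ E]
variable {G : Type*} [TopologicalSpace G] [ChartedSpace E G] [Group G]
variable {V : Type*} [NormedAddCommGroup V] [NormedSpace ℝ V]

/-- The advected quantity `a₀ g⁻¹` as a function of the position of `g` in a chart. -/
def chartAdvected (ρ : Gᵐᵒᵖ →* (V →L[ℝ] V)) (a₀ : StrongDual ℝ V)
    (φ : OpenPartialHomeomorph G E) (q : E) : StrongDual ℝ V :=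
  dualAct ρ a₀ (φ.symm q)⁻¹

omit [NormedSpace ℝ E] [ChartedSpace E G] in
theorem advected_eq_chartAdvected (ρ : Gᵐᵒᵖ →* (V →L[ℝ] V)) (a₀ : StrongDual ℝ V)
    {φ : OpenPartialHomeomorph G E} {g : ℝ → G} {t : ℝ} (ht : g t ∈ φ.source) :
    advected ρ a₀ g t = chartAdvected ρ a₀ φ (φ (g t)) := by
  simp [advected, chartAdvected, φ.left_inv ht]

variable [LieGroup 𝓘(ℝ, E) ∞ G] {ρ : Gᵐᵒᵖ →* (V →L[ℝ] V)}
  (hρ : ContMDiff 𝓘(ℝ, E) 𝓘(ℝ, V →L[ℝ] V) ∞ (fun g : G => ρ (MulOpposite.op g)))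
  {φ : OpenPartialHomeomorph G E}

include hρ

omit [LieGroup 𝓘(ℝ, E) ∞ G] in
theorem fderiv_rep_chartAt_one_symm (ξ : E) :
    fderiv ℝ (fun z => ρ (MulOpposite.op ((chartAt E (1 : G)).symm z))) (chartAt E (1 : G) 1) ξ =
      infAct ρ ξ :=
  (mfderiv_one_eq_fderiv (hρ.contMDiffAt.mdifferentiableAt (by simp)) ξ).symm

omit [LieGroup 𝓘(ℝ, E) ∞ G] in
theorem contDiffAt_rep_chart_symm (hφ : φ ∈ IsManifold.maximalAtlas 𝓘(ℝ, E) ∞ G) {q : E}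
    (hq : q ∈ φ.target) : ContDiffAt ℝ ∞ (fun y => ρ (MulOpposite.op (φ.symm y))) q :=
  (hρ.contMDiffAt.comp q (contMDiffAt_chart_symm hφ hq)).contDiffAt

omit [LieGroup 𝓘(ℝ, E) ∞ G] in
theorem contDiffAt_chartAdvected (hφ : φ ∈ IsManifold.maximalAtlas 𝓘(ℝ, E) ∞ G)
    (a₀ : StrongDual ℝ V) {q : E} (hq : q ∈ φ.target) :
    ContDiffAt ℝ ∞ (chartAdvected ρ a₀ φ) q := by
  have h : chartAdvected ρ a₀ φ = fun y => a₀.comp (ρ (MulOpposite.op (φ.symm y))) := by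
    funext y
    simp [chartAdvected, dualAct]
  rw [h]
  exact contDiffAt_const.clm_comp (contDiffAt_rep_chart_symm hρ hφ hq)

/-- For a right action the factorization x = (x x₀⁻¹) x₀ gives a₀ ∘ ρ(x) = (a₀ ∘ ρ(x₀)) ∘ ρ(x x₀⁻¹),
so only the derivative of ρ at `1` enters. The sign comes from the minus in `dualInfAct`. -/
theorem fderiv_chartAdvected (hφ : φ ∈ IsManifold.maximalAtlas 𝓘(ℝ, E) ∞ G)
    (a₀ : StrongDual ℝ V) {q : E} (hq : q ∈ φ.target) (w : E) :
    fderiv ℝ (chartAdvected ρ a₀ φ) q w =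
      -(dualInfAct ρ (chartAdvected ρ a₀ φ q) (chartTriv φ q w)) := by
  have hψ := IsManifold.chart_mem_maximalAtlas (I := 𝓘(ℝ, E)) (n := ∞) (1 : G)
  have h1 := hasFDerivAt_chartTriv hφ hq
  have h2 : HasFDerivAt (fun z => ρ (MulOpposite.op ((chartAt E (1 : G)).symm z)))
      (fderiv ℝ (fun z => ρ (MulOpposite.op ((chartAt E (1 : G)).symm z)))
        (chartAt E (1 : G) 1)) (chartAt E (1 : G) (φ.symm q * (φ.symm q)⁻¹)) := by
    rw [mul_inv_cancel]
    exact ((contDiffAt_rep_chart_symm hρ hψ (mem_chart_target E 1)).differentiableAt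
      (by simp)).hasFDerivAt
  have h3 := HasFDerivAt.comp (f := fun y => chartAt E (1 : G) (φ.symm y * (φ.symm q)⁻¹)) q h2 h1
  have h4 := ((ContinuousLinearMap.compL ℝ V V ℝ)
    (chartAdvected ρ a₀ φ q)).hasFDerivAt.comp q h3
  have h5 : chartAdvected ρ a₀ φ =ᶠ[𝓝 q]
      ((ContinuousLinearMap.compL ℝ V V ℝ) (chartAdvected ρ a₀ φ q)) ∘
        ((fun z => ρ (MulOpposite.op ((chartAt E (1 : G)).symm z))) ∘
          fun y => chartAt E (1 : G) (φ.symm y * (φ.symm q)⁻¹)) := by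
    have hc1 : ContinuousAt (fun y => φ.symm y * (φ.symm q)⁻¹) q :=
      (((contMDiffAt_chart_symm hφ hq).mul
        (contMDiffAt_const (c := (φ.symm q)⁻¹))).continuousAt)
    have hs : (chartAt E (1 : G)).source ∈ 𝓝 (φ.symm q * (φ.symm q)⁻¹) := by
      rw [mul_inv_cancel]
      exact (chartAt E (1 : G)).open_source.mem_nhds (mem_chart_source E 1)
    filter_upwards [hc1 hs] with y hy
    have hy' : φ.symm y * (φ.symm q)⁻¹ ∈ (chartAt E (1 : G)).source := hy
    have hmul : ρ (MulOpposite.op (φ.symm y)) =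
        ρ (MulOpposite.op (φ.symm q)) * ρ (MulOpposite.op (φ.symm y * (φ.symm q)⁻¹)) := by
      rw [← map_mul, ← MulOpposite.op_mul, inv_mul_cancel_right]
    simp only [chartAdvected, dualAct, inv_inv, Function.comp_apply,
      (chartAt E (1 : G)).left_inv hy', ContinuousLinearMap.compL_apply]
    rw [hmul, ContinuousLinearMap.mul_def, ContinuousLinearMap.comp_assoc]
  rw [h5.fderiv_eq, h4.fderiv]
  simp only [ContinuousLinearMap.comp_apply, fderiv_rep_chartAt_one_symm hρ, dualInfAct,
    neg_neg, ContinuousLinearMap.compL_apply]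

omit hρ in
variable (ρ) in
/-- The action of `𝔤` on `V` as a continuous linear map into the bounded operators. -/
def infActCLM : E →L[ℝ] (V →L[ℝ] V) :=
  mfderiv 𝓘(ℝ, E) 𝓘(ℝ, V →L[ℝ] V) (fun g : G => ρ (MulOpposite.op g)) (1 : G)

omit [LieGroup 𝓘(ℝ, E) ∞ G] hρ in
theorem dualInfAct_eq (a : StrongDual ℝ V) (ξ : E) :
    dualInfAct ρ a ξ = -(a.comp (infActCLM ρ ξ)) := rfl

end Advection

/-! ### Smoothness of the reduced Lagrangian and of its partial derivatives. -/

section Lagrangians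

variable {E : Type*} [NormedAddCommGroup E] [NormedSpace ℝ E]
variable {G : Type*} [TopologicalSpace G] [ChartedSpace E G] [Group G]
variable {V : Type*} [NormedAddCommGroup V] [NormedSpace ℝ V]

theorem contMDiff_totalSpace_mk_one [IsManifold 𝓘(ℝ, E) ∞ G] :
    ContMDiff 𝓘(ℝ, E) 𝓘(ℝ, E).tangent ∞
      (fun ξ : E => (⟨(1 : G), ξ⟩ : TangentBundle 𝓘(ℝ, E) G)) := by
  intro ξ
  rw [Bundle.contMDiffAt_totalSpace]
  refine ⟨contMDiffAt_const, ?_⟩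
  have : (fun x : E => ((trivializationAt E (TangentSpace 𝓘(ℝ, E)) (1 : G))
      (⟨(1 : G), x⟩ : TangentBundle 𝓘(ℝ, E) G)).2) = id := by
    funext x
    exact tangentCoordChange_self (I := 𝓘(ℝ, E)) (mem_extChartAt_source (1 : G))
  exact this ▸ contMDiffAt_id

theorem contDiff_reduced [IsManifold 𝓘(ℝ, E) ∞ G]
    {L : TangentBundle 𝓘(ℝ, E) G × StrongDual ℝ V → ℝ}
    (hL : ContMDiff (𝓘(ℝ, E).tangent.prod 𝓘(ℝ, StrongDual ℝ V)) 𝓘(ℝ, ℝ) ∞ L) :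
    ContDiff ℝ ∞ (fun p : E × StrongDual ℝ V => reduced L p.1 p.2) := by
  have h1 : ContMDiff 𝓘(ℝ, E × StrongDual ℝ V) (𝓘(ℝ, E).tangent.prod 𝓘(ℝ, StrongDual ℝ V)) ∞
      (fun p : E × StrongDual ℝ V =>
        (((⟨(1 : G), p.1⟩ : TangentBundle 𝓘(ℝ, E) G)), p.2)) :=
    (contMDiff_totalSpace_mk_one.comp contDiff_fst.contMDiff).prodMk contDiff_snd.contMDiff
  exact (hL.comp h1).contDiff

variable {l : E → StrongDual ℝ V → ℝ}
  (hl : ContDiff ℝ ∞ (fun p : E × StrongDual ℝ V => l p.1 p.2))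

include hl

theorem dXi_eq (ξ : E) (a : StrongDual ℝ V) :
    dXi l ξ a = (fderiv ℝ (fun p : E × StrongDual ℝ V => l p.1 p.2) (ξ, a)).comp
      (ContinuousLinearMap.inl ℝ E (StrongDual ℝ V)) :=
  (HasFDerivAt.comp (g := fun p : E × StrongDual ℝ V => l p.1 p.2) (f := fun ζ => (ζ, a)) ξ
    ((hl.differentiable (by simp)) (ξ, a)).hasFDerivAt (hasFDerivAt_prodMk_left ξ a)).fderiv

theorem dA_eq (ξ : E) (a : StrongDual ℝ V) :
    dA l ξ a = (fderiv ℝ (fun p : E × StrongDual ℝ V => l p.1 p.2) (ξ, a)).comp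
      (ContinuousLinearMap.inr ℝ E (StrongDual ℝ V)) :=
  (HasFDerivAt.comp (g := fun p : E × StrongDual ℝ V => l p.1 p.2) (f := fun b => (ξ, b)) a
    ((hl.differentiable (by simp)) (ξ, a)).hasFDerivAt (hasFDerivAt_prodMk_right ξ a)).fderiv

theorem contDiff_dXi : ContDiff ℝ ∞ (fun p : E × StrongDual ℝ V => dXi l p.1 p.2) := by
  simp only [dXi_eq hl]
  exact (hl.fderiv_right (by simp)).clm_comp contDiff_const

theorem contDiff_dA : ContDiff ℝ ∞ (fun p : E × StrongDual ℝ V => dA l p.1 p.2) := by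
  simp only [dA_eq hl]
  exact (hl.fderiv_right (by simp)).clm_comp contDiff_const

theorem hasFDerivAt_lagrangian (ξ : E) (a : StrongDual ℝ V) :
    HasFDerivAt (fun p : E × StrongDual ℝ V => l p.1 p.2)
      ((dXi l ξ a).coprod (dA l ξ a)) (ξ, a) := by
  have h : (dXi l ξ a).coprod (dA l ξ a) =
      fderiv ℝ (fun p : E × StrongDual ℝ V => l p.1 p.2) (ξ, a) := by
    ext p
    · simp [dXi_eq hl]
    · simp [dA_eq hl]
  rw [h]
  exact ((hl.differentiable (by simp)) (ξ, a)).hasFDerivAt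

end Lagrangians

/-! ### The invariant Lagrangian in a chart. -/

section LocalLagrangian

variable {E : Type*} [NormedAddCommGroup E] [NormedSpace ℝ E]
variable {G : Type*} [TopologicalSpace G] [ChartedSpace E G] [Group G] [LieGroup 𝓘(ℝ, E) ∞ G]
variable {V : Type*} [NormedAddCommGroup V] [NormedSpace ℝ V]
  {ρ : Gᵐᵒᵖ →* (V →L[ℝ] V)} {φ : OpenPartialHomeomorph G E}

theorem localLagrangian_eq {L : TangentBundle 𝓘(ℝ, E) G × StrongDual ℝ V → ℝ}
    (hinv : RightInvariant ρ L) (a₀ : StrongDual ℝ V)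
    (hφ : φ ∈ IsManifold.maximalAtlas 𝓘(ℝ, E) ∞ G) {q : E} (hq : q ∈ φ.target) (u : E) :
    localLagrangian (fun v : TangentBundle 𝓘(ℝ, E) G => L (v, a₀)) φ q u =
      reduced L (chartTriv φ q u) (chartAdvected ρ a₀ φ q) := by
  rw [← rightTriv_mfderiv_chart_symm hφ hq u]
  exact (reduced_rightTriv ρ L hinv (φ.symm q) _ a₀).symm

end LocalLagrangian

/-! ### The Euler–Poincaré expression. -/

section EulerPoincareForm

variable {E : Type*} [NormedAddCommGroup E] [NormedSpace ℝ E]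
variable {G : Type*} [TopologicalSpace G] [ChartedSpace E G] [Group G]
variable {V : Type*} [NormedAddCommGroup V] [NormedSpace ℝ V]

/-- The difference of the two sides of the Euler-Poincaré equations, evaluated on `η`. -/
def eulerPoincareForm (ρ : Gᵐᵒᵖ →* (V →L[ℝ] V)) (l : E → StrongDual ℝ V → ℝ)
    (ξ : ℝ → E) (a : ℝ → StrongDual ℝ V) (t : ℝ) (η : E) : ℝ :=
  deriv (fun s => dXi l (ξ s) (a s)) t η + dXi l (ξ t) (a t) (bracket G (ξ t) η) +
    dA l (ξ t) (a t) (dualInfAct ρ (a t) η)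

variable {ρ : Gᵐᵒᵖ →* (V →L[ℝ] V)} {l : E → StrongDual ℝ V → ℝ}
  (hl : ContDiff ℝ ∞ (fun p : E × StrongDual ℝ V => l p.1 p.2))
  {ξ : ℝ → E} {a : ℝ → StrongDual ℝ V}

include hl

theorem contDiffAt_dXi_comp {t : ℝ} (hξ : ContDiffAt ℝ ∞ ξ t) (ha : ContDiffAt ℝ ∞ a t) :
    ContDiffAt ℝ ∞ (fun s => dXi l (ξ s) (a s)) t :=
  (contDiff_dXi hl).contDiffAt.comp (f := fun s => (ξ s, a s)) t (hξ.prodMk ha)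

theorem contDiffAt_dA_comp {t : ℝ} (hξ : ContDiffAt ℝ ∞ ξ t) (ha : ContDiffAt ℝ ∞ a t) :
    ContDiffAt ℝ ∞ (fun s => dA l (ξ s) (a s)) t :=
  (contDiff_dA hl).contDiffAt.comp (f := fun s => (ξ s, a s)) t (hξ.prodMk ha)

theorem hasDerivAt_dXi_comp {t : ℝ} (hξ : ContDiffAt ℝ ∞ ξ t) (ha : ContDiffAt ℝ ∞ a t) :
    HasDerivAt (fun s => dXi l (ξ s) (a s)) (deriv (fun s => dXi l (ξ s) (a s)) t) t :=
  ((contDiffAt_dXi_comp hl hξ ha).differentiableAt (by simp)).hasDerivAt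

/-- The momentum is differentiable because `l`, ξ and a are smooth, so the existence of the
derivative costs nothing and only the identity of values remains. -/
theorem eulerPoincareEquations_iff {t₁ t₂ : ℝ} (hξ : ∀ t ∈ Icc t₁ t₂, ContDiffAt ℝ ∞ ξ t)
    (ha : ∀ t ∈ Icc t₁ t₂, ContDiffAt ℝ ∞ a t) :
    EulerPoincareEquations ρ l ξ a t₁ t₂ ↔
      ∀ t ∈ Icc t₁ t₂, ∀ η, eulerPoincareForm ρ l ξ a t η = 0 := by
  refine forall₂_congr fun t ht => ?_
  constructor
  · rintro ⟨μ', hμ, h⟩ η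
    have := congrFun h η
    simp only [Pi.add_apply, Pi.neg_apply, adStar, diamond] at this
    rw [eulerPoincareForm, hμ.deriv, this]
    ring
  · intro h
    refine ⟨_, hasDerivAt_dXi_comp hl (hξ t ht) (ha t ht), ?_⟩
    funext η
    have := h η
    simp only [Pi.add_apply, Pi.neg_apply, adStar, diamond]
    rw [eulerPoincareForm] at this
    linarith

theorem contDiffAt_eulerPoincareForm [LieGroup 𝓘(ℝ, E) ∞ G] {t : ℝ} (hξ : ContDiffAt ℝ ∞ ξ t)
    (ha : ContDiffAt ℝ ∞ a t) {η : ℝ → E} (hη : ContDiffAt ℝ ∞ η t) :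
    ContDiffAt ℝ ∞ (fun s => eulerPoincareForm ρ l ξ a s (η s)) t := by
  have h1 := contDiffAt_dXi_comp hl hξ ha
  have h2 := contDiffAt_dA_comp hl hξ ha
  have h3 : ContDiffAt ℝ ∞ (deriv (fun s => dXi l (ξ s) (a s))) t := by
    have : ContDiffAt ℝ ∞ (fun s => fderiv ℝ (fun s => dXi l (ξ s) (a s)) s 1) t :=
      (h1.fderiv_right (by simp)).clm_apply contDiffAt_const
    exact this
  have h4 : ContDiffAt ℝ ∞ (fun s => bracketCLM E G (ξ s) (η s)) t :=
    ((bracketCLM E G).contDiff.contDiffAt.comp t hξ).clm_apply hη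
  have h5 : ContDiffAt ℝ ∞ (fun s => dualInfAct ρ (a s) (η s)) t := by
    simp only [dualInfAct_eq]
    exact (ha.clm_comp ((infActCLM ρ).contDiff.contDiffAt.comp t hη)).neg
  simp only [bracketCLM_apply] at h4
  exact ((h3.clm_apply hη).add (h1.clm_apply h4)).add (h2.clm_apply h5)

end EulerPoincareForm

/-! ### Euler–Lagrange equations in charts against Euler–Poincaré equations. -/

section EulerLagrange

variable {E : Type*} [NormedAddCommGroup E] [NormedSpace ℝ E]
variable {G : Type*} [TopologicalSpace G] [ChartedSpace E G] [Group G]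
variable {V : Type*} [NormedAddCommGroup V] [NormedSpace ℝ V]
  {ρ : Gᵐᵒᵖ →* (V →L[ℝ] V)}

-- Order one is used because being C^∞ at a point gives C^n nearby for each finite n, on a
-- neighbourhood that may shrink with n.
omit [Group G] in
theorem eventually_mdifferentiableAt [IsManifold 𝓘(ℝ, E) ∞ G] {F : Type*} [NormedAddCommGroup F]
    [NormedSpace ℝ F] {f : F → G} {x : F} (hf : ContMDiffAt 𝓘(ℝ, F) 𝓘(ℝ, E) ∞ f x) :
    ∀ᶠ y in 𝓝 x, MDifferentiableAt 𝓘(ℝ, F) 𝓘(ℝ, E) f y := by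
  have : IsManifold 𝓘(ℝ, E) 1 G := IsManifold.of_le (n := ∞) (by simp)
  filter_upwards [(contMDiffAt_iff_contMDiffAt_nhds (by simp)).1 (hf.of_le (m := 1) (by simp))] with y hy
  exact hy.mdifferentiableAt (by simp)

variable [LieGroup 𝓘(ℝ, E) ∞ G]

section Curve

variable {φ : OpenPartialHomeomorph G E} {g : ℝ → G} {t : ℝ}

theorem eventually_rightVelocity_eq (hφ : φ ∈ IsManifold.maximalAtlas 𝓘(ℝ, E) ∞ G)
    (hg : ContMDiffAt 𝓘(ℝ, ℝ) 𝓘(ℝ, E) ∞ g t) (ht : g t ∈ φ.source) :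
    ∀ᶠ s in 𝓝 t, rightVelocity g s = chartTriv φ (φ (g s)) (deriv (fun r => φ (g r)) s) := by
  filter_upwards [eventually_mdifferentiableAt hg,
    hg.continuousAt (φ.open_source.mem_nhds ht)] with s hs hs'
  exact rightVelocity_eq_chartTriv hφ hs hs'

omit [Group G] [LieGroup 𝓘(ℝ, E) ∞ G] in
theorem contDiffAt_deriv_chart_comp (hφ : φ ∈ IsManifold.maximalAtlas 𝓘(ℝ, E) ∞ G)
    (hg : ContMDiffAt 𝓘(ℝ, ℝ) 𝓘(ℝ, E) ∞ g t) (ht : g t ∈ φ.source) :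
    ContDiffAt ℝ ∞ (deriv (fun r => φ (g r))) t := by
  have : ContDiffAt ℝ ∞ (fun s => fderiv ℝ (fun r => φ (g r)) s 1) t :=
    ((contDiffAt_chart_comp hφ hg ht).fderiv_right (by simp)).clm_apply contDiffAt_const
  exact this

theorem contDiffAt_rightVelocity (hg : ContMDiffAt 𝓘(ℝ, ℝ) 𝓘(ℝ, E) ∞ g t) :
    ContDiffAt ℝ ∞ (rightVelocity (E := E) g) t := by
  have hφ := IsManifold.chart_mem_maximalAtlas (I := 𝓘(ℝ, E)) (n := ∞) (g t)
  have ht := mem_chart_source E (g t)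
  refine ContDiffAt.congr_of_eventuallyEq ?_ (eventually_rightVelocity_eq hφ hg ht)
  exact ((contDiffAt_chartTriv hφ ((chartAt E (g t)).map_source ht)).comp t
    (contDiffAt_chart_comp hφ hg ht)).clm_apply (contDiffAt_deriv_chart_comp hφ hg ht)

omit [LieGroup 𝓘(ℝ, E) ∞ G] in
theorem contDiffAt_rep_comp {F : Type*} [NormedAddCommGroup F] [NormedSpace ℝ F]
    (hρ : ContMDiff 𝓘(ℝ, E) 𝓘(ℝ, V →L[ℝ] V) ∞ (fun g : G => ρ (MulOpposite.op g)))
    (a₀ : StrongDual ℝ V) {f : F → G} {x : F} (hf : ContMDiffAt 𝓘(ℝ, F) 𝓘(ℝ, E) ∞ f x) :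
    ContDiffAt ℝ ∞ (fun y => dualAct ρ a₀ (f y)⁻¹) x := by
  have h : (fun y => dualAct ρ a₀ (f y)⁻¹) = fun y => a₀.comp (ρ (MulOpposite.op (f y))) := by
    funext y
    simp [dualAct]
  rw [h]
  exact contDiffAt_const.clm_comp (hρ.contMDiffAt.comp x hf).contDiffAt

omit [LieGroup 𝓘(ℝ, E) ∞ G] in
theorem contDiffAt_advected
    (hρ : ContMDiff 𝓘(ℝ, E) 𝓘(ℝ, V →L[ℝ] V) ∞ (fun g : G => ρ (MulOpposite.op g)))
    (a₀ : StrongDual ℝ V) (hg : ContMDiffAt 𝓘(ℝ, ℝ) 𝓘(ℝ, E) ∞ g t) :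
    ContDiffAt ℝ ∞ (advected ρ a₀ g) t :=
  contDiffAt_rep_comp hρ a₀ hg

/-- The advection equation `ȧ = -a ξ`. -/
theorem hasDerivAt_advected
    (hρ : ContMDiff 𝓘(ℝ, E) 𝓘(ℝ, V →L[ℝ] V) ∞ (fun g : G => ρ (MulOpposite.op g)))
    (a₀ : StrongDual ℝ V) (hg : MDifferentiableAt 𝓘(ℝ, ℝ) 𝓘(ℝ, E) g t) :
    HasDerivAt (advected ρ a₀ g)
      (-(dualInfAct ρ (advected ρ a₀ g t) (rightVelocity (E := E) g t))) t := by
  have hφ := IsManifold.chart_mem_maximalAtlas (I := 𝓘(ℝ, E)) (n := ∞) (g t)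
  have ht := mem_chart_source E (g t)
  have htt := (chartAt E (g t)).map_source ht
  rw [rightVelocity_eq_chartTriv hφ hg ht, advected_eq_chartAdvected ρ a₀ ht,
    ← fderiv_chartAdvected hρ hφ a₀ htt]
  have h1 : DifferentiableAt ℝ (fun s => chartAt E (g t) (g s)) t :=
    (((contMDiffAt_of_mem_maximalAtlas hφ ht).mdifferentiableAt (by simp)).comp t
      hg).differentiableAt
  have h2 := ((contDiffAt_chartAdvected hρ hφ a₀ htt).differentiableAt (by simp)).hasFDerivAt
  refine (h2.comp_hasDerivAt t h1.hasDerivAt).congr_of_eventuallyEq ?_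
  filter_upwards [hg.continuousAt ((chartAt E (g t)).open_source.mem_nhds ht)] with s hs
  exact advected_eq_chartAdvected ρ a₀ hs

/-- At each time, the Euler-Lagrange equation in a chart is the Euler-Poincaré equation. -/
theorem hasDerivAt_localLagrangian_iff
    (hρ : ContMDiff 𝓘(ℝ, E) 𝓘(ℝ, V →L[ℝ] V) ∞ (fun g : G => ρ (MulOpposite.op g)))
    {L : TangentBundle 𝓘(ℝ, E) G × StrongDual ℝ V → ℝ}
    (hL : ContMDiff (𝓘(ℝ, E).tangent.prod 𝓘(ℝ, StrongDual ℝ V)) 𝓘(ℝ, ℝ) ∞ L)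
    (hinv : RightInvariant ρ L) (a₀ : StrongDual ℝ V)
    (hφ : φ ∈ IsManifold.maximalAtlas 𝓘(ℝ, E) ∞ G)
    (hg : ContMDiffAt 𝓘(ℝ, ℝ) 𝓘(ℝ, E) ∞ g t) (ht : g t ∈ φ.source) :
    HasDerivAt
      (fun s => fderiv ℝ (fun u => localLagrangian
        (fun v : TangentBundle 𝓘(ℝ, E) G => L (v, a₀)) φ (φ (g s)) u) (deriv (fun r => φ (g r)) s))
      (fderiv ℝ (fun q => localLagrangian
        (fun v : TangentBundle 𝓘(ℝ, E) G => L (v, a₀)) φ q (deriv (fun r => φ (g r)) t))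
        (φ (g t))) t ↔
    ∀ η, eulerPoincareForm ρ (reduced L) (rightVelocity g) (advected ρ a₀ g) t η = 0 := by
  have hl := contDiff_reduced hL
  set l : E → StrongDual ℝ V → ℝ := reduced L with hl_def
  set q : ℝ → E := fun r => φ (g r) with hq_def
  set Ω := chartTriv φ with hΩ_def
  set α := chartAdvected ρ a₀ φ with hα_def
  set ξ : ℝ → E := rightVelocity g
  set a := advected ρ a₀ g
  have hqt : q t ∈ φ.target := φ.map_source ht
  have hξt : ξ t = Ω (q t) (deriv q t) := (eventually_rightVelocity_eq hφ hg ht).self_of_nhds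
  have hat : a t = α (q t) := advected_eq_chartAdvected ρ a₀ ht
  have hq1 : HasDerivAt q (deriv q t) t :=
    ((contDiffAt_chart_comp hφ hg ht).differentiableAt (by simp)).hasDerivAt
  have hΩ1 : HasFDerivAt Ω (fderiv ℝ Ω (q t)) (q t) :=
    ((contDiffAt_chartTriv hφ hqt).differentiableAt (by simp)).hasFDerivAt
  have hα1 : HasFDerivAt α (fderiv ℝ α (q t)) (q t) :=
    ((contDiffAt_chartAdvected hρ hφ a₀ hqt).differentiableAt (by simp)).hasFDerivAt
  have hμ := hasDerivAt_dXi_comp hl (contDiffAt_rightVelocity (E := E) hg)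
    (contDiffAt_advected hρ a₀ hg)
  -- the momentum
  have hp : (fun s => fderiv ℝ (fun u => localLagrangian
      (fun v : TangentBundle 𝓘(ℝ, E) G => L (v, a₀)) φ (q s) u) (deriv q s)) =ᶠ[𝓝 t]
      fun s => (dXi l (ξ s) (a s)).comp (Ω (q s)) := by
    filter_upwards [eventually_rightVelocity_eq hφ hg ht,
      hg.continuousAt (φ.open_source.mem_nhds ht)] with s hs hs'
    have hqs : q s ∈ φ.target := φ.map_source hs'
    have has : a s = α (q s) := advected_eq_chartAdvected ρ a₀ hs'
    have h1 : (fun u => localLagrangian (fun v : TangentBundle 𝓘(ℝ, E) G => L (v, a₀)) φ (q s) u) =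
        (fun p : E × StrongDual ℝ V => l p.1 p.2) ∘ fun u => (Ω (q s) u, α (q s)) := by
      funext u
      exact localLagrangian_eq hinv a₀ hφ hqs u
    have h2 := (hasFDerivAt_lagrangian hl (Ω (q s) (deriv q s)) (α (q s))).comp
      (f := fun u => (Ω (q s) u, α (q s))) (deriv q s)
      ((Ω (q s)).hasFDerivAt.prodMk (hasFDerivAt_const _ _))
    rw [h1, h2.fderiv, has, show ξ s = _ from hs]
    ext u
    simp
    rfl
  have hpd : HasDerivAt (fun s => (dXi l (ξ s) (a s)).comp (Ω (q s)))
      ((deriv (fun s => dXi l (ξ s) (a s)) t).comp (Ω (q t)) +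
        (dXi l (ξ t) (a t)).comp (fderiv ℝ Ω (q t) (deriv q t))) t :=
    hμ.clm_comp (hΩ1.comp_hasDerivAt t hq1)
  -- the force
  have hf : fderiv ℝ (fun x => localLagrangian
      (fun v : TangentBundle 𝓘(ℝ, E) G => L (v, a₀)) φ x (deriv q t)) (q t) =
      (dXi l (ξ t) (a t)).comp ((ContinuousLinearMap.apply ℝ E (deriv q t)).comp
        (fderiv ℝ Ω (q t))) + (dA l (ξ t) (a t)).comp (fderiv ℝ α (q t)) := by
    have h1 : (fun x => localLagrangian (fun v : TangentBundle 𝓘(ℝ, E) G => L (v, a₀)) φ x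
        (deriv q t)) =ᶠ[𝓝 (q t)]
        (fun p : E × StrongDual ℝ V => l p.1 p.2) ∘ fun x => (Ω x (deriv q t), α x) := by
      filter_upwards [φ.open_target.mem_nhds hqt] with x hx
      exact localLagrangian_eq hinv a₀ hφ hx _
    have h2 := (hasFDerivAt_lagrangian hl (Ω (q t) (deriv q t)) (α (q t))).comp
      (f := fun x => (Ω x (deriv q t), α x)) (q t)
      (((ContinuousLinearMap.apply ℝ E (deriv q t)).hasFDerivAt.comp (q t) hΩ1).prodMk hα1)
    rw [h1.fderiv_eq, h2.fderiv, hξt, hat]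
    ext u
    simp
  rw [hf, hp.hasDerivAt_iff]
  have hiff : HasDerivAt (fun s => (dXi l (ξ s) (a s)).comp (Ω (q s)))
      ((dXi l (ξ t) (a t)).comp ((ContinuousLinearMap.apply ℝ E (deriv q t)).comp
        (fderiv ℝ Ω (q t))) + (dA l (ξ t) (a t)).comp (fderiv ℝ α (q t))) t ↔
      ∀ w, eulerPoincareForm ρ l ξ a t (Ω (q t) w) = 0 := by
    -- With u = q̇, Maurer–Cartan turns the bracket into DΩ(q̇)w − DΩ(w)q̇: the first term belongs
    -- to ṗ, the second to the force, together with the derivative of α.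
    have hw : ∀ w, eulerPoincareForm ρ l ξ a t (Ω (q t) w) =
        ((deriv (fun s => dXi l (ξ s) (a s)) t).comp (Ω (q t)) +
          (dXi l (ξ t) (a t)).comp (fderiv ℝ Ω (q t) (deriv q t))) w -
        ((dXi l (ξ t) (a t)).comp ((ContinuousLinearMap.apply ℝ E (deriv q t)).comp
        (fderiv ℝ Ω (q t))) + (dA l (ξ t) (a t)).comp (fderiv ℝ α (q t))) w := by
      intro w
      have h1 := fderiv_chartTriv_sub hφ hqt w (deriv q t)
      have h2 := fderiv_chartAdvected hρ hφ a₀ hqt w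
      rw [← hΩ_def, ← hξt, neg_eq_iff_eq_neg.symm] at h1
      rw [← hα_def, ← hat] at h2
      simp only [eulerPoincareForm, ← h1, h2, add_apply, ContinuousLinearMap.comp_apply,
        ContinuousLinearMap.apply_apply, map_neg, map_sub]
      ring
    constructor
    · intro h w
      rw [hw, h.unique hpd, sub_self]
    · intro h
      convert hpd using 1
      ext w
      have := h w
      rw [hw, sub_eq_zero] at this
      exact this.symm
  rw [hiff]
  exact ((chartTriv_surjective hφ hqt).forall (p := fun η =>
    eulerPoincareForm ρ l ξ a t η = 0)).symm

end Curve

/-- The pointwise condition is the same in all charts around g(t), so the preferred chart there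
already gives the Euler–Poincaré equation. -/
theorem eulerLagrange_iff
    (hρ : ContMDiff 𝓘(ℝ, E) 𝓘(ℝ, V →L[ℝ] V) ∞ (fun g : G => ρ (MulOpposite.op g)))
    {L : TangentBundle 𝓘(ℝ, E) G × StrongDual ℝ V → ℝ}
    (hL : ContMDiff (𝓘(ℝ, E).tangent.prod 𝓘(ℝ, StrongDual ℝ V)) 𝓘(ℝ, ℝ) ∞ L)
    (hinv : RightInvariant ρ L) (a₀ : StrongDual ℝ V) {g : ℝ → G} {t₁ t₂ : ℝ}
    (hg : ∀ t ∈ Icc t₁ t₂, ContMDiffAt 𝓘(ℝ, ℝ) 𝓘(ℝ, E) ∞ g t) :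
    EulerLagrange (fun v : TangentBundle 𝓘(ℝ, E) G => L (v, a₀)) g t₁ t₂ ↔
      EulerPoincareEquations ρ (reduced L) (rightVelocity g) (advected ρ a₀ g) t₁ t₂ := by
  rw [eulerPoincareEquations_iff (contDiff_reduced hL)
    (fun t ht => contDiffAt_rightVelocity (hg t ht))
    (fun t ht => contDiffAt_advected hρ a₀ (hg t ht))]
  constructor
  · intro h t ht
    have hφ := IsManifold.chart_mem_maximalAtlas (I := 𝓘(ℝ, E)) (n := ∞) (g t)
    exact (hasDerivAt_localLagrangian_iff hρ hL hinv a₀ hφ (hg t ht) (mem_chart_source E _)).1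
      (h _ hφ t ht (mem_chart_source E _))
  · intro h φ hφ t ht hgt
    exact (hasDerivAt_localLagrangian_iff hρ hL hinv a₀ hφ (hg t ht) hgt).2 (h t ht)

end EulerLagrange

/-! ### Linear ODEs, differentiation under the integral, the fundamental lemma. -/

section Analysis

open MeasureTheory

/-- Uniqueness for linear differential equations on a closed interval, with the initial time
anywhere in the interval. -/
theorem eqOn_Icc_of_linearODE {W : Type*} [NormedAddCommGroup W] [NormedSpace ℝ W]
    {T : ℝ → W →L[ℝ] W} {t₁ t₂ t₀ : ℝ} (hT : ContinuousOn T (Icc t₁ t₂)) (ht₀ : t₀ ∈ Icc t₁ t₂)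
    {b c : ℝ → W} (hb : ∀ t ∈ Icc t₁ t₂, HasDerivWithinAt b (T t (b t)) (Icc t₁ t₂) t)
    (hc : ∀ t ∈ Icc t₁ t₂, HasDerivWithinAt c (T t (c t)) (Icc t₁ t₂) t) (h : b t₀ = c t₀) :
    EqOn b c (Icc t₁ t₂) := by
  obtain ⟨K, hK⟩ := isCompact_Icc.exists_bound_of_continuousOn hT
  have hlip : ∀ t ∈ Icc t₁ t₂, LipschitzOnWith K.toNNReal (fun x => T t x) univ := fun t ht =>
    ((T t).lipschitz.weaken ((Real.le_toNNReal_iff_coe_le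
      ((norm_nonneg _).trans (hK t ht))).2 (hK t ht))).lipschitzOnWith
  have cont : ∀ {f : ℝ → W}, (∀ t ∈ Icc t₁ t₂, HasDerivWithinAt f (T t (f t)) (Icc t₁ t₂) t) →
      ContinuousOn f (Icc t₁ t₂) := fun hf t ht => (hf t ht).continuousWithinAt
  have hr : Icc t₀ t₂ ⊆ Icc t₁ t₂ := Icc_subset_Icc_left ht₀.1
  have hl : Icc t₁ t₀ ⊆ Icc t₁ t₂ := Icc_subset_Icc_right ht₀.2
  have dr : ∀ {f : ℝ → W}, (∀ t ∈ Icc t₁ t₂, HasDerivWithinAt f (T t (f t)) (Icc t₁ t₂) t) →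
      ∀ t ∈ Ico t₀ t₂, HasDerivWithinAt f (T t (f t)) (Ici t) t := fun hf t ht =>
    (hf t (hr (Ico_subset_Icc_self ht))).mono_of_mem_nhdsWithin
      (Filter.mem_of_superset (Icc_mem_nhdsGE ht.2) (Icc_subset_Icc_left (ht₀.1.trans ht.1)))
  have dl : ∀ {f : ℝ → W}, (∀ t ∈ Icc t₁ t₂, HasDerivWithinAt f (T t (f t)) (Icc t₁ t₂) t) →
      ∀ t ∈ Ioc t₁ t₀, HasDerivWithinAt f (T t (f t)) (Iic t) t := fun hf t ht =>
    (hf t (hl (Ioc_subset_Icc_self ht))).mono_of_mem_nhdsWithin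
      (Filter.mem_of_superset (Icc_mem_nhdsLE ht.1) (Icc_subset_Icc_right (ht.2.trans ht₀.2)))
  -- Uniqueness is applied backward and forward from `t₀` separately.
  rw [← Icc_union_Icc_eq_Icc ht₀.1 ht₀.2]
  apply EqOn.union
  · exact ODE_solution_unique_of_mem_Icc_left (v := fun t x => T t x) (s := fun _ => univ)
      (fun t ht => hlip t (hl (Ioc_subset_Icc_self ht))) ((cont hb).mono hl) (dl hb)
      (fun _ _ => mem_univ _) ((cont hc).mono hl) (dl hc) (fun _ _ => mem_univ _) h
  · exact ODE_solution_unique_of_mem_Icc_right (v := fun t x => T t x) (s := fun _ => univ)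
      (fun t ht => hlip t (hr (Ico_subset_Icc_self ht))) ((cont hb).mono hr) (dr hb)
      (fun _ _ => mem_univ _) ((cont hc).mono hr) (dr hc) (fun _ _ => mem_univ _) h

/-- Differentiation under the integral sign over a compact interval. -/
theorem hasDerivAt_intervalIntegral_of_contDiffAt {Φ : ℝ → ℝ → ℝ} {t₁ t₂ : ℝ} (ht : t₁ ≤ t₂)
    (hΦ : ∀ t ∈ Icc t₁ t₂, ContDiffAt ℝ 1 (fun p : ℝ × ℝ => Φ p.1 p.2) (0, t)) :
    HasDerivAt (fun ε => ∫ t in t₁..t₂, Φ ε t) (∫ t in t₁..t₂, deriv (fun ε => Φ ε t) 0) 0 := by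
  set f : ℝ × ℝ → ℝ := fun p => Φ p.1 p.2 with hf
  set U : Set (ℝ × ℝ) := {p | ContDiffAt ℝ 1 f p} with hU
  have hUd : ∀ p ∈ U, ContDiffAt ℝ 1 f p := fun p hp => hp
  have hUo : IsOpen U := isOpen_iff_mem_nhds.2 fun p hp => (hUd p hp).eventually (by simp)
  -- Smoothness is known only near each point of {0} × [t₁, t₂]; compactness gives one ε-interval
  -- valid for all t, hence a uniform bound on the derivative.
  obtain ⟨u, v, huo, -, hu, hv, huv⟩ := generalized_tube_lemma (isCompact_singleton (x := (0 : ℝ)))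
    (isCompact_Icc (a := t₁) (b := t₂)) hUo (by
      rintro ⟨x, t⟩ ⟨hx, ht'⟩
      rw [mem_singleton_iff] at hx
      simp only at hx
      rw [hx]
      exact hΦ t ht')
  obtain ⟨δ, hδ, hδu⟩ := Metric.nhds_basis_closedBall.mem_iff.1 (huo.mem_nhds (hu rfl))
  have hK : Metric.closedBall (0 : ℝ) δ ×ˢ Icc t₁ t₂ ⊆ U :=
    (prod_mono hδu hv).trans huv
  have hKc : IsCompact (Metric.closedBall (0 : ℝ) δ ×ˢ Icc t₁ t₂) :=
    (isCompact_closedBall _ _).prod isCompact_Icc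
  have hder : ∀ p ∈ U, HasDerivAt (fun ε => Φ ε p.2) (fderiv ℝ f p (1, 0)) p.1 := by
    intro p hp
    have h1 : HasFDerivAt f (fderiv ℝ f p) (p.1, p.2) :=
      ((hUd p hp).differentiableAt (by simp)).hasFDerivAt
    exact h1.comp_hasDerivAt p.1 ((hasDerivAt_id p.1).prodMk (hasDerivAt_const p.1 p.2))
  have hcf : ContinuousOn f (Metric.closedBall (0 : ℝ) δ ×ˢ Icc t₁ t₂) := fun p hp =>
    (hUd p (hK hp)).continuousAt.continuousWithinAt
  have hcd : ContinuousOn (fun p => fderiv ℝ f p (1, 0))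
      (Metric.closedBall (0 : ℝ) δ ×ˢ Icc t₁ t₂) := fun p hp =>
    (((hUd p (hK hp)).fderiv_right (m := 0) (by simp)).continuousAt.clm_apply
      continuousAt_const).continuousWithinAt
  obtain ⟨C, hC⟩ := hKc.exists_bound_of_continuousOn hcd
  have hslice : ∀ ε ∈ Metric.closedBall (0 : ℝ) δ, MapsTo (fun t : ℝ => ((ε, t) : ℝ × ℝ))
      (Icc t₁ t₂) (Metric.closedBall (0 : ℝ) δ ×ˢ Icc t₁ t₂) := fun ε hε t ht' => ⟨hε, ht'⟩
  have hcts : ∀ ε ∈ Metric.closedBall (0 : ℝ) δ, ContinuousOn (Φ ε) (Icc t₁ t₂) := fun ε hε =>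
    hcf.comp (by fun_prop) (hslice ε hε)
  have hsub : uIoc t₁ t₂ ⊆ Icc t₁ t₂ := by
    rw [uIoc_of_le ht]; exact Ioc_subset_Icc_self
  have h0 : (0 : ℝ) ∈ Metric.closedBall (0 : ℝ) δ := Metric.mem_closedBall_self hδ.le
  have main := intervalIntegral.hasDerivAt_integral_of_dominated_loc_of_deriv_le
    (μ := volume) (a := t₁) (b := t₂) (F := Φ) (F' := fun ε t => fderiv ℝ f (ε, t) (1, 0))
    (x₀ := 0) (bound := fun _ => C) (Metric.closedBall_mem_nhds (0 : ℝ) hδ)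
    (by
      filter_upwards [Metric.closedBall_mem_nhds (0 : ℝ) hδ] with ε hε
      exact ((hcts ε hε).mono hsub).aestronglyMeasurable measurableSet_uIoc)
    (by
      apply ContinuousOn.intervalIntegrable
      rw [uIcc_of_le ht]
      exact hcts 0 h0)
    (((hcd.comp (by fun_prop) (hslice 0 h0)).mono hsub).aestronglyMeasurable measurableSet_uIoc)
    (Filter.Eventually.of_forall fun t ht' ε hε => hC (ε, t) ⟨hε, hsub ht'⟩)
    intervalIntegrable_const
    (Filter.Eventually.of_forall fun t ht' ε hε => hder (ε, t) (hK ⟨hε, hsub ht'⟩))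
  refine main.2.congr_deriv (intervalIntegral.integral_congr fun t ht' => ?_)
  rw [uIcc_of_le ht] at ht'
  exact (hder (0, t) (hK ⟨h0, ht'⟩)).deriv.symm

/-- The fundamental lemma of the calculus of variations on a closed interval. -/
theorem eqOn_zero_of_intervalIntegral_mul_eq_zero {c : ℝ → ℝ} {t₁ t₂ : ℝ} (ht : t₁ < t₂)
    (hc : ContinuousOn c (Icc t₁ t₂))
    (h : ∀ f : ℝ → ℝ, ContDiff ℝ ∞ f → f t₁ = 0 → f t₂ = 0 → ∫ t in t₁..t₂, f t * c t = 0) :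
    ∀ t ∈ Icc t₁ t₂, c t = 0 := by
  have hae : ∀ᵐ x, x ∈ Ioo t₁ t₂ → c x = 0 := by
    apply isOpen_Ioo.ae_eq_zero_of_integral_contDiff_smul_eq_zero
    · exact (hc.mono Ioo_subset_Icc_self).locallyIntegrableOn measurableSet_Ioo
    · intro f hf _ hsupp
      have hz : ∀ x, x ∉ Ioo t₁ t₂ → f x = 0 := fun x hx =>
        image_eq_zero_of_notMem_tsupport fun hx' => hx (hsupp hx')
      have h1 := h f hf (hz _ (by simp)) (hz _ (by simp))
      rw [intervalIntegral.integral_of_le ht.le] at h1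
      rw [← h1]
      refine (setIntegral_eq_integral_of_forall_compl_eq_zero fun x hx => ?_).symm
      rw [hz x fun hx' => hx (Ioo_subset_Ioc_self hx')]
      simp
  have hres : c =ᵐ[volume.restrict (Icc t₁ t₂)] fun _ => 0 := by
    rw [← restrict_Ioo_eq_restrict_Icc]
    exact (ae_restrict_iff' measurableSet_Ioo).2 hae
  -- Continuity upgrades a.e. vanishing to vanishing everywhere, endpoints included.
  exact Measure.eqOn_Icc_of_ae_eq volume ht.ne hres hc continuousOn_const

end Analysis

/-! ### First variation of the reduced action. -/

section ConstrainedVariations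

variable {E : Type*} [NormedAddCommGroup E] [NormedSpace ℝ E]
variable {G : Type*} [TopologicalSpace G] [ChartedSpace E G] [Group G] [LieGroup 𝓘(ℝ, E) ∞ G]
variable {V : Type*} [NormedAddCommGroup V] [NormedSpace ℝ V]
  {ρ : Gᵐᵒᵖ →* (V →L[ℝ] V)} {l : E → StrongDual ℝ V → ℝ}
  (hl : ContDiff ℝ ∞ (fun p : E × StrongDual ℝ V => l p.1 p.2))
  {ξ : ℝ → E} {a : ℝ → StrongDual ℝ V} {t₁ t₂ : ℝ}
  (hξ : ∀ t ∈ Icc t₁ t₂, ContDiffAt ℝ ∞ ξ t) (ha : ∀ t ∈ Icc t₁ t₂, ContDiffAt ℝ ∞ a t)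

include hl hξ ha

/-- The first variation of the reduced action under constrained variations. -/
theorem hasDerivAt_integral_constrained (ht : t₁ < t₂) {η : ℝ → E} {Ξ : ℝ → ℝ → E}
    {A : ℝ → ℝ → StrongDual ℝ V}
    (hη : ∀ t ∈ Icc t₁ t₂, ContDiffAt ℝ ∞ η t) (h₁ : η t₁ = 0) (h₂ : η t₂ = 0)
    (hΞ : ∀ t ∈ Icc t₁ t₂, ContDiffAt ℝ ∞ (fun p : ℝ × ℝ => Ξ p.1 p.2) (0, t))
    (hA : ∀ t ∈ Icc t₁ t₂, ContDiffAt ℝ ∞ (fun p : ℝ × ℝ => A p.1 p.2) (0, t))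
    (hΞ0 : ∀ t ∈ Icc t₁ t₂, Ξ 0 t = ξ t) (hA0 : ∀ t ∈ Icc t₁ t₂, A 0 t = a t)
    (hδΞ : ∀ t ∈ Icc t₁ t₂,
      HasDerivAt (fun ε => Ξ ε t) (deriv η t - bracket G (ξ t) (η t)) 0)
    (hδA : ∀ t ∈ Icc t₁ t₂, HasDerivAt (fun ε => A ε t) (-(dualInfAct ρ (a t) (η t))) 0) :
    HasDerivAt (fun ε : ℝ => ∫ t in t₁..t₂, l (Ξ ε t) (A ε t))
      (-∫ t in t₁..t₂, eulerPoincareForm ρ l ξ a t (η t)) 0 := by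
  have h := hasDerivAt_intervalIntegral_of_contDiffAt (Φ := fun ε t => l (Ξ ε t) (A ε t)) ht.le
    (fun t ht => (hl.contDiffAt.comp (f := fun p : ℝ × ℝ => (Ξ p.1 p.2, A p.1 p.2)) (0, t)
      ((hΞ t ht).prodMk (hA t ht))).of_le (by simp))
  refine h.congr_deriv ?_
  have hη' : ∀ t ∈ Icc t₁ t₂, HasDerivAt η (deriv η t) t := fun t ht =>
    ((hη t ht).differentiableAt (by simp)).hasDerivAt
  have hμ := fun t ht => hasDerivAt_dXi_comp hl (hξ t ht) (ha t ht)
  set D : ℝ → ℝ := fun t => deriv (fun s => dXi l (ξ s) (a s)) t (η t) +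
    dXi l (ξ t) (a t) (deriv η t) with hD
  have hP : ∀ t ∈ Icc t₁ t₂, HasDerivAt (fun s => dXi l (ξ s) (a s) (η s)) (D t) t :=
    fun t ht => (hμ t ht).clm_apply (hη' t ht)
  have hDc : ContinuousOn D (Icc t₁ t₂) := by
    intro t ht
    have c1 := contDiffAt_dXi_comp hl (hξ t ht) (ha t ht)
    have c2 : ContinuousAt (fun s => fderiv ℝ (fun s => dXi l (ξ s) (a s)) s 1) t :=
      ((c1.fderiv_right (m := ∞) (by simp)).clm_apply contDiffAt_const).continuousAt
    have c3 : ContinuousAt (fun s => fderiv ℝ η s 1) t :=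
      (((hη t ht).fderiv_right (m := ∞) (by simp)).clm_apply contDiffAt_const).continuousAt
    exact ((c2.clm_apply (hη t ht).continuousAt).add
      (c1.continuousAt.clm_apply c3)).continuousWithinAt
  have hEc : ContinuousOn (fun t => eulerPoincareForm ρ l ξ a t (η t)) (Icc t₁ t₂) :=
    fun t ht => (contDiffAt_eulerPoincareForm hl (hξ t ht) (ha t ht)
      (hη t ht)).continuousAt.continuousWithinAt
  rw [← uIcc_of_le ht.le] at hDc hEc
  have hFTC := intervalIntegral.integral_eq_sub_of_hasDerivAt
    (fun t ht' => hP t (by rwa [uIcc_of_le ht.le] at ht')) hDc.intervalIntegrable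
  rw [h₁, h₂, map_zero, map_zero, sub_zero] at hFTC
  -- Integration by parts: `D` is the derivative of ⟨δl/δξ, η⟩ and integrates to zero. Adding it
  -- cancels the derivative of the momentum and leaves the ε-derivative of l.
  have hsub : -∫ t in t₁..t₂, eulerPoincareForm ρ l ξ a t (η t) =
      ∫ t in t₁..t₂, (D t - eulerPoincareForm ρ l ξ a t (η t)) := by
    rw [intervalIntegral.integral_sub hDc.intervalIntegrable hEc.intervalIntegrable, hFTC,
      zero_sub]
  rw [hsub]
  refine intervalIntegral.integral_congr fun t ht' => ?_
  rw [uIcc_of_le ht.le] at ht'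
  have hd : HasFDerivAt (fun p : E × StrongDual ℝ V => l p.1 p.2)
      ((dXi l (ξ t) (a t)).coprod (dA l (ξ t) (a t))) (Ξ 0 t, A 0 t) := by
    rw [hΞ0 t ht', hA0 t ht']
    exact hasFDerivAt_lagrangian hl _ _
  have hd2 := hd.comp_hasDerivAt (f := fun ε => (Ξ ε t, A ε t)) 0
    ((hδΞ t ht').prodMk (hδA t ht'))
  refine hd2.deriv.trans ?_
  simp only [ContinuousLinearMap.coprod_apply, map_sub, map_neg, hD, eulerPoincareForm]
  ring

theorem constrainedPrinciple_of_eulerPoincareForm (ht : t₁ < t₂)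
    (h : ∀ t ∈ Icc t₁ t₂, ∀ η, eulerPoincareForm ρ l ξ a t η = 0) :
    ConstrainedPrinciple ρ l ξ a t₁ t₂ := by
  intro η Ξ A hη h₁ h₂ hΞ hA hΞ0 hA0 hδΞ hδA
  refine (hasDerivAt_integral_constrained hl hξ ha ht hη h₁ h₂ hΞ hA hΞ0 hA0 hδΞ
    hδA).congr_deriv ?_
  rw [neg_eq_zero]
  refine intervalIntegral.integral_zero_ae (Filter.Eventually.of_forall fun t ht' => ?_)
  rw [uIoc_of_le ht.le] at ht'
  exact h t (Ioc_subset_Icc_self ht') _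

omit hl hξ ha in
theorem eulerPoincareForm_smul (c : ℝ) (t : ℝ) (e : E) :
    eulerPoincareForm ρ l ξ a t (c • e) = c * eulerPoincareForm ρ l ξ a t e := by
  simp only [eulerPoincareForm, ← bracketCLM_apply, dualInfAct_eq, map_smul,
    ContinuousLinearMap.comp_smul, map_neg, smul_eq_mul]
  ring

/-- For fixed `e` the form is linear in the scalar `f t`, so the scalar fundamental lemma suffices
even when 𝔤 is infinite dimensional. -/
theorem eulerPoincareForm_eq_zero_of_integral (ht : t₁ < t₂)
    (h : ∀ (f : ℝ → ℝ) (e : E), ContDiff ℝ ∞ f → f t₁ = 0 → f t₂ = 0 →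
      ∫ t in t₁..t₂, eulerPoincareForm ρ l ξ a t (f t • e) = 0) :
    ∀ t ∈ Icc t₁ t₂, ∀ η, eulerPoincareForm ρ l ξ a t η = 0 := by
  intro t ht' e
  refine eqOn_zero_of_intervalIntegral_mul_eq_zero ht
    (c := fun t => eulerPoincareForm ρ l ξ a t e) (fun t ht =>
      (contDiffAt_eulerPoincareForm hl (hξ t ht) (ha t ht)
        contDiffAt_const).continuousAt.continuousWithinAt) (fun f hf h₁ h₂ => ?_) t ht'
  simp only [← eulerPoincareForm_smul]
  exact h f e hf h₁ h₂

end ConstrainedVariations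

/-! ### Two-parameter families in the group. -/

section Variations

variable {E : Type*} [NormedAddCommGroup E] [NormedSpace ℝ E]
variable {G : Type*} [TopologicalSpace G] [ChartedSpace E G] [Group G] [LieGroup 𝓘(ℝ, E) ∞ G]
variable {V : Type*} [NormedAddCommGroup V] [NormedSpace ℝ V]
  {ρ : Gᵐᵒᵖ →* (V →L[ℝ] V)} {Γ : ℝ → ℝ → G} {ε t : ℝ}

section

variable (hΓ : ContMDiffAt 𝓘(ℝ, ℝ × ℝ) 𝓘(ℝ, E) ∞ (fun p : ℝ × ℝ => Γ p.1 p.2) (ε, t))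
  {φ : OpenPartialHomeomorph G E} (hφ : φ ∈ IsManifold.maximalAtlas 𝓘(ℝ, E) ∞ G)
  (hs : Γ ε t ∈ φ.source)

include hΓ hφ hs

/-- Both partial velocities take the form Ω(x) Dx(v), with v = (0, 1) or (1, 0), so one derivative
formula serves for both. -/
theorem eventually_rightVelocity_family_eq :
    ∀ᶠ p : ℝ × ℝ in 𝓝 (ε, t),
      rightVelocity (Γ p.1) p.2 = chartTriv φ (φ (Γ p.1 p.2))
        (fderiv ℝ (fun p : ℝ × ℝ => φ (Γ p.1 p.2)) p (0, 1)) ∧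
      rightVelocity (fun e => Γ e p.2) p.1 = chartTriv φ (φ (Γ p.1 p.2))
        (fderiv ℝ (fun p : ℝ × ℝ => φ (Γ p.1 p.2)) p (1, 0)) := by
  have hx := (contDiffAt_chart_comp hφ hΓ hs).of_le (m := 1) (by simp)
  filter_upwards [eventually_mdifferentiableAt hΓ,
    hΓ.continuousAt (φ.open_source.mem_nhds hs), hx.eventually (by simp)] with p hp hps hpx
  have hd : HasFDerivAt (fun p : ℝ × ℝ => φ (Γ p.1 p.2)) _ (p.1, p.2) :=
    (hpx.differentiableAt (by simp)).hasFDerivAt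
  have hp' : MDifferentiableAt 𝓘(ℝ, ℝ × ℝ) 𝓘(ℝ, E) (fun p : ℝ × ℝ => Γ p.1 p.2) (p.1, p.2) := hp
  constructor
  · have h1 : MDifferentiableAt 𝓘(ℝ, ℝ) 𝓘(ℝ, E) (Γ p.1) p.2 :=
      hp'.comp (f := fun s : ℝ => (p.1, s)) p.2
        ((differentiableAt_const _).prodMk differentiableAt_id).mdifferentiableAt
    rw [rightVelocity_eq_chartTriv hφ h1 hps]
    exact congrArg _ (hd.comp_hasDerivAt (f := fun s => (p.1, s)) p.2
      ((hasDerivAt_const p.2 p.1).prodMk (hasDerivAt_id p.2))).deriv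
  · have h1 : MDifferentiableAt 𝓘(ℝ, ℝ) 𝓘(ℝ, E) (fun e => Γ e p.2) p.1 :=
      hp'.comp (f := fun s : ℝ => (s, p.2)) p.1
        (differentiableAt_id.prodMk (differentiableAt_const _)).mdifferentiableAt
    rw [rightVelocity_eq_chartTriv hφ h1 hps]
    exact congrArg _ (hd.comp_hasDerivAt (f := fun s => (s, p.2)) p.1
      ((hasDerivAt_id p.1).prodMk (hasDerivAt_const p.1 p.2))).deriv

theorem contDiffAt_chartTriv_fderiv_family (v : ℝ × ℝ) :
    ContDiffAt ℝ ∞ (fun p : ℝ × ℝ => chartTriv φ (φ (Γ p.1 p.2))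
      (fderiv ℝ (fun p : ℝ × ℝ => φ (Γ p.1 p.2)) p v)) (ε, t) :=
  ((contDiffAt_chartTriv hφ (φ.map_source hs)).comp (f := fun p : ℝ × ℝ => φ (Γ p.1 p.2)) (ε, t)
    (contDiffAt_chart_comp hφ hΓ hs)).clm_apply
    (((contDiffAt_chart_comp hφ hΓ hs).fderiv_right (by simp)).clm_apply contDiffAt_const)

/-- The derivative of the trivialized partial derivatives of a two-parameter family. -/
theorem hasFDerivAt_chartTriv_fderiv_family (v : ℝ × ℝ) :
    HasFDerivAt (fun p : ℝ × ℝ => chartTriv φ (φ (Γ p.1 p.2))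
      (fderiv ℝ (fun p : ℝ × ℝ => φ (Γ p.1 p.2)) p v))
      ((chartTriv φ (φ (Γ ε t))).comp ((ContinuousLinearMap.apply ℝ E v).comp
          (fderiv ℝ (fderiv ℝ (fun p : ℝ × ℝ => φ (Γ p.1 p.2))) (ε, t))) +
        (ContinuousLinearMap.apply ℝ E (fderiv ℝ (fun p : ℝ × ℝ => φ (Γ p.1 p.2)) (ε, t) v)).comp
          ((fderiv ℝ (chartTriv φ) (φ (Γ ε t))).comp
            (fderiv ℝ (fun p : ℝ × ℝ => φ (Γ p.1 p.2)) (ε, t)))) (ε, t) := by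
  have hx := contDiffAt_chart_comp hφ hΓ hs
  have h1 : HasFDerivAt (fun p : ℝ × ℝ => φ (Γ p.1 p.2)) _ (ε, t) :=
    (hx.differentiableAt (by simp)).hasFDerivAt
  have h2 : HasFDerivAt (fderiv ℝ (fun p : ℝ × ℝ => φ (Γ p.1 p.2))) _ (ε, t) :=
    ((hx.fderiv_right (m := ∞) (by simp)).differentiableAt (by simp)).hasFDerivAt
  have h3 : HasFDerivAt (chartTriv φ) _ (φ (Γ ε t)) :=
    ((contDiffAt_chartTriv hφ (φ.map_source hs)).differentiableAt (by simp)).hasFDerivAt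
  exact (h3.comp (f := fun p : ℝ × ℝ => φ (Γ p.1 p.2)) (ε, t) h1).clm_apply
    ((ContinuousLinearMap.apply ℝ E v).hasFDerivAt.comp (ε, t) h2)

end

variable (hΓ : ContMDiffAt 𝓘(ℝ, ℝ × ℝ) 𝓘(ℝ, E) ∞ (fun p : ℝ × ℝ => Γ p.1 p.2) (ε, t))

include hΓ

theorem contDiffAt_rightVelocity_family :
    ContDiffAt ℝ ∞ (fun p : ℝ × ℝ => rightVelocity (E := E) (Γ p.1) p.2) (ε, t) := by
  have hφ := IsManifold.chart_mem_maximalAtlas (I := 𝓘(ℝ, E)) (n := ∞) (Γ ε t)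
  have hs := mem_chart_source E (Γ ε t)
  refine (contDiffAt_chartTriv_fderiv_family hΓ hφ hs (0, 1)).congr_of_eventuallyEq ?_
  filter_upwards [eventually_rightVelocity_family_eq hΓ hφ hs] with p hp using hp.1

theorem contDiffAt_variationField :
    ContDiffAt ℝ ∞ (fun s => rightVelocity (E := E) (fun e => Γ e s) ε) t := by
  have hφ := IsManifold.chart_mem_maximalAtlas (I := 𝓘(ℝ, E)) (n := ∞) (Γ ε t)
  have hs := mem_chart_source E (Γ ε t)
  have h : ContDiffAt ℝ ∞ (fun p : ℝ × ℝ => rightVelocity (E := E) (fun e => Γ e p.2) p.1)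
      (ε, t) := by
    refine (contDiffAt_chartTriv_fderiv_family hΓ hφ hs (1, 0)).congr_of_eventuallyEq ?_
    filter_upwards [eventually_rightVelocity_family_eq hΓ hφ hs] with p hp using hp.2
  exact h.comp (f := fun s : ℝ => (ε, s)) t (contDiffAt_const.prodMk contDiffAt_id)

/-- The variation of `ξ = ġ g⁻¹` under a variation of `g` with variation field `η g`. -/
theorem hasDerivAt_rightVelocity_family :
    HasDerivAt (fun e => rightVelocity (E := E) (Γ e) t)
      (deriv (fun s => rightVelocity (E := E) (fun e => Γ e s) ε) t -
        bracket G (rightVelocity (E := E) (Γ ε) t)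
          (rightVelocity (E := E) (fun e => Γ e t) ε)) ε := by
  have hφ := IsManifold.chart_mem_maximalAtlas (I := 𝓘(ℝ, E)) (n := ∞) (Γ ε t)
  have hs := mem_chart_source E (Γ ε t)
  set φ := chartAt E (Γ ε t)
  have hev := eventually_rightVelocity_family_eq hΓ hφ hs
  have hpt := hev.self_of_nhds
  have h1 : HasFDerivAt (fun p : ℝ × ℝ => rightVelocity (E := E) (Γ p.1) p.2) _ (ε, t) :=
    (hasFDerivAt_chartTriv_fderiv_family hΓ hφ hs (0, 1)).congr_of_eventuallyEq
      (hev.mono fun p hp => hp.1)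
  have h2 : HasFDerivAt (fun p : ℝ × ℝ => rightVelocity (E := E) (fun e => Γ e p.2) p.1) _ (ε, t) :=
    (hasFDerivAt_chartTriv_fderiv_family hΓ hφ hs (1, 0)).congr_of_eventuallyEq
      (hev.mono fun p hp => hp.2)
  have d1 := h1.comp_hasDerivAt ε (f := fun e => (e, t))
    ((hasDerivAt_id ε).prodMk (hasDerivAt_const ε t))
  have d2 := h2.comp_hasDerivAt t (f := fun s => (ε, s))
    ((hasDerivAt_const t ε).prodMk (hasDerivAt_id t))
  refine d1.congr_deriv ?_
  have d2' := d2.deriv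
  simp only [Function.comp_def] at d2'
  rw [d2']
  have hx := contDiffAt_chart_comp hφ hΓ hs
  -- In ∂_ε(Ω x_t) − ∂_t(Ω x_ε) the mixed derivatives of x cancel; DΩ(x_ε)x_t − DΩ(x_t)x_ε remains,
  -- which is −[ξ, η] by Maurer–Cartan.
  have hsymm := hx.isSymmSndFDerivAt (by simpa using ENat.LEInfty.out) (1, 0) (0, 1)
  have hMC := fderiv_chartTriv_sub hφ (φ.map_source hs)
    (fderiv ℝ (fun p : ℝ × ℝ => φ (Γ p.1 p.2)) (ε, t) (1, 0))
    (fderiv ℝ (fun p : ℝ × ℝ => φ (Γ p.1 p.2)) (ε, t) (0, 1))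
  simp only at hpt
  rw [← hpt.1, ← hpt.2] at hMC
  simp only [add_apply, ContinuousLinearMap.comp_apply, ContinuousLinearMap.apply_apply, hsymm]
  rw [sub_eq_add_neg _ (bracket G _ _), ← hMC]
  abel

/-- The advected quantity depends only on the position in `G`, so this is the advection equation
along the curve ε ↦ Γ(ε, t). -/
theorem hasDerivAt_advected_family
    (hρ : ContMDiff 𝓘(ℝ, E) 𝓘(ℝ, V →L[ℝ] V) ∞ (fun g : G => ρ (MulOpposite.op g)))
    (a₀ : StrongDual ℝ V) :
    HasDerivAt (fun e => advected ρ a₀ (Γ e) t)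
      (-(dualInfAct ρ (advected ρ a₀ (Γ ε) t) (rightVelocity (E := E) (fun e => Γ e t) ε))) ε :=
  hasDerivAt_advected (g := fun e => Γ e t) hρ a₀
    (MDifferentiableAt.comp (f := fun e : ℝ => (e, t)) ε (hΓ.mdifferentiableAt (by simp))
      (differentiableAt_id.prodMk (differentiableAt_const _)).mdifferentiableAt)

end Variations

/-! ### First variation of the unreduced action, and a supply of variations. -/

section Hamilton

variable {E : Type*} [NormedAddCommGroup E] [NormedSpace ℝ E]
variable {G : Type*} [TopologicalSpace G] [ChartedSpace E G] [Group G] [LieGroup 𝓘(ℝ, E) ∞ G]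
variable {V : Type*} [NormedAddCommGroup V] [NormedSpace ℝ V] {ρ : Gᵐᵒᵖ →* (V →L[ℝ] V)}

/-- A variation agrees with `g` at ε = 0 only on the closed interval. At an endpoint both curves are
differentiable, and the one-sided derivative determines the velocity. -/
theorem rightVelocity_congr_of_eqOn_Icc {c g : ℝ → G} {t₁ t₂ t : ℝ} (h12 : t₁ < t₂)
    (ht : t ∈ Icc t₁ t₂) (hc : MDifferentiableAt 𝓘(ℝ, ℝ) 𝓘(ℝ, E) c t)
    (hg : MDifferentiableAt 𝓘(ℝ, ℝ) 𝓘(ℝ, E) g t) (h : EqOn c g (Icc t₁ t₂)) :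
    rightVelocity (E := E) c t = rightVelocity (E := E) g t := by
  have hφ := IsManifold.chart_mem_maximalAtlas (I := 𝓘(ℝ, E)) (n := ∞) (g t)
  have hs := mem_chart_source E (g t)
  have hs' : c t ∈ (chartAt E (g t)).source := by rw [h ht]; exact hs
  have hd : ∀ {k : ℝ → G}, MDifferentiableAt 𝓘(ℝ, ℝ) 𝓘(ℝ, E) k t →
      k t ∈ (chartAt E (g t)).source →
      DifferentiableAt ℝ (fun s => chartAt E (g t) (k s)) t := fun hk hkt =>
    (((contMDiffAt_of_mem_maximalAtlas hφ hkt).mdifferentiableAt (by simp)).comp t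
      hk).differentiableAt
  have hu := uniqueDiffOn_Icc h12 t ht
  rw [rightVelocity_eq_chartTriv hφ hc hs', rightVelocity_eq_chartTriv hφ hg hs, h ht,
    ← (hd hc hs').derivWithin hu, ← (hd hg hs).derivWithin hu]
  congr 1
  exact derivWithin_congr (fun s hs => congrArg _ (h hs)) (congrArg _ (h ht))

/-- Makes the variation field vanish at the fixed endpoints. -/
theorem rightVelocity_eq_zero_of_eventually_const {c : ℝ → G} {t : ℝ} {k : G}
    (h : ∀ᶠ s in 𝓝 t, c s = k) : rightVelocity (E := E) c t = 0 := by
  have hφ := IsManifold.chart_mem_maximalAtlas (I := 𝓘(ℝ, E)) (n := ∞) (c t)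
  have hc : MDifferentiableAt 𝓘(ℝ, ℝ) 𝓘(ℝ, E) c t :=
    mdifferentiableAt_const.congr_of_eventuallyEq h
  rw [rightVelocity_eq_chartTriv hφ hc (mem_chart_source E _)]
  have h2 : (fun s => chartAt E (c t) (c s)) =ᶠ[𝓝 t] fun _ => chartAt E (c t) k := by
    filter_upwards [h] with s hs
    rw [hs]
  rw [h2.deriv_eq, deriv_const, map_zero]

variable (hρ : ContMDiff 𝓘(ℝ, E) 𝓘(ℝ, V →L[ℝ] V) ∞ (fun g : G => ρ (MulOpposite.op g)))
  {L : TangentBundle 𝓘(ℝ, E) G × StrongDual ℝ V → ℝ}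
  (hL : ContMDiff (𝓘(ℝ, E).tangent.prod 𝓘(ℝ, StrongDual ℝ V)) 𝓘(ℝ, ℝ) ∞ L)
  (hinv : RightInvariant ρ L) (a₀ : StrongDual ℝ V) {g : ℝ → G} {t₁ t₂ : ℝ}
  (hg : ∀ t ∈ Icc t₁ t₂, ContMDiffAt 𝓘(ℝ, ℝ) 𝓘(ℝ, E) ∞ g t)

include hρ hL hinv hg

/-- The first variation of the action. -/
theorem hasDerivAt_action (ht : t₁ < t₂) {Γ : ℝ → ℝ → G}
    (hΓ : IsVariation (E := E) g t₁ t₂ Γ) :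
    HasDerivAt (fun ε : ℝ => ∫ t in t₁..t₂, L (curveLift (Γ ε) t, a₀))
      (-∫ t in t₁..t₂, eulerPoincareForm ρ (reduced L) (rightVelocity g) (advected ρ a₀ g) t
        (rightVelocity (E := E) (fun e => Γ e t) 0)) 0 := by
  -- This holds for every ε without differentiability of `Γ ε`: invariance applies to whatever
  -- tangent vector `velocity` returns.
  have hL' : (fun ε : ℝ => ∫ t in t₁..t₂, L (curveLift (Γ ε) t, a₀)) = fun ε : ℝ =>
      ∫ t in t₁..t₂, reduced L (rightVelocity (Γ ε) t) (advected ρ a₀ (Γ ε) t) := by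
    funext ε
    refine intervalIntegral.integral_congr fun t _ => ?_
    exact (reduced_rightTriv ρ L hinv (Γ ε t) (velocity (Γ ε) t) a₀).symm
  have hΓ0 : ∀ t ∈ Icc t₁ t₂, MDifferentiableAt 𝓘(ℝ, ℝ) 𝓘(ℝ, E) (Γ 0) t := fun t ht' =>
    MDifferentiableAt.comp (f := fun s : ℝ => ((0 : ℝ), s)) t
      ((hΓ.smooth t ht').mdifferentiableAt (by simp))
      ((differentiableAt_const _).prodMk differentiableAt_id).mdifferentiableAt
  have hξ : ∀ t ∈ Icc t₁ t₂, rightVelocity (E := E) (Γ 0) t = rightVelocity (E := E) g t :=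
    fun t ht' => rightVelocity_congr_of_eqOn_Icc ht ht' (hΓ0 t ht')
      ((hg t ht').mdifferentiableAt (by simp)) hΓ.base
  have ha : ∀ t ∈ Icc t₁ t₂, advected ρ a₀ (Γ 0) t = advected ρ a₀ g t := fun t ht' => by
    simp only [advected, hΓ.base t ht']
  rw [hL']
  refine hasDerivAt_integral_constrained (contDiff_reduced hL)
    (fun t ht => contDiffAt_rightVelocity (hg t ht))
    (fun t ht => contDiffAt_advected hρ a₀ (hg t ht)) ht
    (fun t ht => contDiffAt_variationField (hΓ.smooth t ht))
    (rightVelocity_eq_zero_of_eventually_const hΓ.left)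
    (rightVelocity_eq_zero_of_eventually_const hΓ.right)
    (fun t ht => contDiffAt_rightVelocity_family (hΓ.smooth t ht))
    (fun t ht => contDiffAt_rep_comp hρ a₀ (hΓ.smooth t ht)) hξ ha
    (fun t ht' => ?_) (fun t ht' => ?_)
  · rw [← hξ t ht']
    exact hasDerivAt_rightVelocity_family (hΓ.smooth t ht')
  · rw [← ha t ht']
    exact hasDerivAt_advected_family (hΓ.smooth t ht') hρ a₀

omit hρ hL hinv in
/-- The variation `ψ⁻¹(ψ(1) + ε f(t) e) g(t)` of `g`, with `ψ` a chart at `1`, has the variation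
field `f e`. -/
theorem exists_isVariation {f : ℝ → ℝ} (hf : ContDiff ℝ ∞ f) (h₁ : f t₁ = 0) (h₂ : f t₂ = 0)
    (e : E) : ∃ Γ : ℝ → ℝ → G, IsVariation (E := E) g t₁ t₂ Γ ∧
      ∀ t ∈ Icc t₁ t₂, rightVelocity (E := E) (fun ε => Γ ε t) 0 = f t • e := by
  have hψ := IsManifold.chart_mem_maximalAtlas (I := 𝓘(ℝ, E)) (n := ∞) (1 : G)
  set ψ := chartAt E (1 : G) with hψ_def
  set x : ℝ × ℝ → E := fun p => ψ 1 + (p.1 * f p.2) • e with hx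
  have hxs : ContDiff ℝ ∞ x := by
    have : ContDiff ℝ ∞ (fun p : ℝ × ℝ => p.1 * f p.2) :=
      contDiff_fst.mul (hf.comp contDiff_snd)
    exact contDiff_const.add (this.smul contDiff_const)
  have hx0 : ∀ t, x (0, t) = ψ 1 := fun t => by simp [hx]
  set Γ : ℝ → ℝ → G := fun ε t => ψ.symm (x (ε, t)) * g t with hΓ
  have hψ1 : ψ.symm (ψ 1) = 1 := chartAt_symm_chartAt_one
  have hbase : ∀ t, Γ 0 t = g t := fun t => by simp only [hΓ, hx0, hψ1, one_mul]
  have hsm : ∀ t ∈ Icc t₁ t₂,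
      ContMDiffAt 𝓘(ℝ, ℝ × ℝ) 𝓘(ℝ, E) ∞ (fun p : ℝ × ℝ => Γ p.1 p.2) (0, t) := by
    intro t ht
    -- For large ε the point may leave the chart target, but `IsVariation` asks for smoothness only
    -- at ε = 0.
    have c1 : ContMDiffAt 𝓘(ℝ, E) 𝓘(ℝ, E) ∞ ψ.symm (x (0, t)) := by
      rw [hx0]
      exact contMDiffAt_chart_symm hψ (mem_chart_target E 1)
    have c2 : ContMDiffAt 𝓘(ℝ, ℝ × ℝ) 𝓘(ℝ, E) ∞ (fun p : ℝ × ℝ => g p.2) (0, t) :=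
      ContMDiffAt.comp (f := fun p : ℝ × ℝ => p.2) (0, t) (hg t ht) contDiffAt_snd.contMDiffAt
    exact (c1.comp (0, t) hxs.contDiffAt.contMDiffAt).mul c2
  have hfix : ∀ t, f t = 0 → ∀ᶠ ε in 𝓝 (0 : ℝ), Γ ε t = g t := fun t h0 =>
    Filter.Eventually.of_forall fun ε => by simp [hΓ, hx, h0, hψ1]
  refine ⟨Γ, ⟨hsm, fun t _ => hbase t, hfix t₁ h₁, hfix t₂ h₂⟩, fun t ht => ?_⟩
  have hd : MDifferentiableAt 𝓘(ℝ, ℝ) 𝓘(ℝ, E) (fun ε => Γ ε t) 0 :=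
    MDifferentiableAt.comp (f := fun ε : ℝ => (ε, t)) 0 ((hsm t ht).mdifferentiableAt (by simp))
      (differentiableAt_id.prodMk (differentiableAt_const _)).mdifferentiableAt
  refine (rightTriv_mfderiv hd (1 : ℝ)).trans ?_
  have hxt : ContinuousAt (fun ε : ℝ => x (ε, t)) 0 :=
    (hxs.continuous.comp (by fun_prop : Continuous fun ε : ℝ => (ε, t))).continuousAt
  -- The factor g(t) cancels on the right, and what remains is affine in ε in the chart ψ.
  have hev : (fun ε => ψ (Γ ε t * (Γ 0 t)⁻¹)) =ᶠ[𝓝 0] fun ε => x (ε, t) := by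
    filter_upwards [hxt (ψ.open_target.mem_nhds (by
      rw [show (fun ε : ℝ => x (ε, t)) 0 = ψ 1 from hx0 t]
      exact mem_chart_target E 1))]
      with ε hε
    rw [hbase]
    simp only [hΓ, mul_inv_cancel_right]
    exact ψ.right_inv hε
  rw [hev.fderiv_eq]
  have hder : HasDerivAt (fun ε : ℝ => x (ε, t)) (f t • e) 0 :=
    ((((hasDerivAt_id (0 : ℝ)).mul_const (f t)).smul_const e).const_add (ψ 1)).congr_deriv
      (by rw [one_mul])
  exact hder.deriv

end Hamilton

/-! ### Affine families with prescribed derivative at ε = 0. -/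

section AffineFamily

variable {W : Type*} [NormedAddCommGroup W] [NormedSpace ℝ W]

theorem contDiffAt_affineFamily {c d : ℝ → W} {t : ℝ} (hc : ContDiffAt ℝ ∞ c t)
    (hd : ContDiffAt ℝ ∞ d t) :
    ContDiffAt ℝ ∞ (fun p : ℝ × ℝ => c p.2 + p.1 • d p.2) (0, t) :=
  (hc.comp (f := fun p : ℝ × ℝ => p.2) (0, t) contDiffAt_snd).add
    (contDiffAt_fst.smul (hd.comp (f := fun p : ℝ × ℝ => p.2) (0, t) contDiffAt_snd))

theorem hasDerivAt_affineFamily (c d : W) : HasDerivAt (fun ε : ℝ => c + ε • d) d 0 :=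
  (((hasDerivAt_id (0 : ℝ)).smul_const d).const_add c).congr_deriv (one_smul ℝ d)

end AffineFamily

/-! ### The variational principles and the advection equation. -/

section Equivalences

variable {E : Type*} [NormedAddCommGroup E] [NormedSpace ℝ E]
variable {G : Type*} [TopologicalSpace G] [ChartedSpace E G] [Group G] [LieGroup 𝓘(ℝ, E) ∞ G]
variable {V : Type*} [NormedAddCommGroup V] [NormedSpace ℝ V] {ρ : Gᵐᵒᵖ →* (V →L[ℝ] V)}

theorem hamiltonPrinciple_iff
    (hρ : ContMDiff 𝓘(ℝ, E) 𝓘(ℝ, V →L[ℝ] V) ∞ (fun g : G => ρ (MulOpposite.op g)))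
    {L : TangentBundle 𝓘(ℝ, E) G × StrongDual ℝ V → ℝ}
    (hL : ContMDiff (𝓘(ℝ, E).tangent.prod 𝓘(ℝ, StrongDual ℝ V)) 𝓘(ℝ, ℝ) ∞ L)
    (hinv : RightInvariant ρ L) (a₀ : StrongDual ℝ V) {g : ℝ → G} {t₁ t₂ : ℝ} (ht : t₁ < t₂)
    (hg : ∀ t ∈ Icc t₁ t₂, ContMDiffAt 𝓘(ℝ, ℝ) 𝓘(ℝ, E) ∞ g t) :
    HamiltonPrinciple (fun v : TangentBundle 𝓘(ℝ, E) G => L (v, a₀)) g t₁ t₂ ↔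
      EulerPoincareEquations ρ (reduced L) (rightVelocity g) (advected ρ a₀ g) t₁ t₂ := by
  have hξ : ∀ t ∈ Icc t₁ t₂, ContDiffAt ℝ ∞ (rightVelocity (E := E) g) t :=
    fun t ht => contDiffAt_rightVelocity (hg t ht)
  have ha : ∀ t ∈ Icc t₁ t₂, ContDiffAt ℝ ∞ (advected ρ a₀ g) t :=
    fun t ht => contDiffAt_advected hρ a₀ (hg t ht)
  have hl := contDiff_reduced hL
  rw [eulerPoincareEquations_iff hl hξ ha]
  constructor
  · intro h
    refine eulerPoincareForm_eq_zero_of_integral hl hξ ha ht fun f e hf h₁ h₂ => ?_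
    obtain ⟨Γ, hΓ, hη⟩ := exists_isVariation hg hf h₁ h₂ e
    have h0 := (h Γ hΓ).unique (hasDerivAt_action hρ hL hinv a₀ hg ht hΓ)
    rw [eq_comm, neg_eq_zero] at h0
    rw [← h0]
    refine intervalIntegral.integral_congr fun t ht' => ?_
    rw [uIcc_of_le ht.le] at ht'
    simp only [hη t ht']
  · intro h Γ hΓ
    refine (hasDerivAt_action hρ hL hinv a₀ hg ht hΓ).congr_deriv ?_
    rw [neg_eq_zero]
    refine intervalIntegral.integral_zero_ae (Filter.Eventually.of_forall fun t ht' => ?_)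
    rw [uIoc_of_le ht.le] at ht'
    exact h t (Ioc_subset_Icc_self ht') _

/-- The first variation depends only on δξ and δa, so affine families in ε are test families enough;
they need not come from curves in `G`, and ξ, a may be any smooth curves. -/
theorem constrainedPrinciple_iff {l : E → StrongDual ℝ V → ℝ}
    (hl : ContDiff ℝ ∞ (fun p : E × StrongDual ℝ V => l p.1 p.2))
    {ξ : ℝ → E} {a : ℝ → StrongDual ℝ V} {t₁ t₂ : ℝ} (ht : t₁ < t₂)
    (hξ : ∀ t ∈ Icc t₁ t₂, ContDiffAt ℝ ∞ ξ t) (ha : ∀ t ∈ Icc t₁ t₂, ContDiffAt ℝ ∞ a t) :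
    ConstrainedPrinciple ρ l ξ a t₁ t₂ ↔ EulerPoincareEquations ρ l ξ a t₁ t₂ := by
  rw [eulerPoincareEquations_iff hl hξ ha]
  refine ⟨fun h => ?_, constrainedPrinciple_of_eulerPoincareForm hl hξ ha ht⟩
  refine eulerPoincareForm_eq_zero_of_integral hl hξ ha ht fun f e hf h₁ h₂ => ?_
  set η : ℝ → E := fun t => f t • e with hη_def
  have hη : ContDiff ℝ ∞ η := hf.smul contDiff_const
  set δξ : ℝ → E := fun t => deriv η t - bracket G (ξ t) (η t) with hδξ_def
  set δa : ℝ → StrongDual ℝ V := fun t => -(dualInfAct ρ (a t) (η t)) with hδa_def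
  have hδξ : ∀ t ∈ Icc t₁ t₂, ContDiffAt ℝ ∞ δξ t := by
    intro t ht
    have c1 : ContDiffAt ℝ ∞ (fun s => fderiv ℝ η s 1) t :=
      (hη.contDiffAt.fderiv_right (by simp)).clm_apply contDiffAt_const
    have c2 : ContDiffAt ℝ ∞ (fun s => bracketCLM E G (ξ s) (η s)) t :=
      ((bracketCLM E G).contDiff.contDiffAt.comp t (hξ t ht)).clm_apply hη.contDiffAt
    simp only [bracketCLM_apply] at c2
    exact c1.sub c2
  have hδa : ∀ t ∈ Icc t₁ t₂, ContDiffAt ℝ ∞ δa t := by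
    intro t ht
    simp only [hδa_def, dualInfAct_eq, neg_neg]
    exact (ha t ht).clm_comp ((infActCLM ρ).contDiff.contDiffAt.comp t hη.contDiffAt)
  have hη₁ : η t₁ = 0 := by simp [hη_def, h₁]
  have hη₂ : η t₂ = 0 := by simp [hη_def, h₂]
  have hΞ : ∀ t ∈ Icc t₁ t₂, ContDiffAt ℝ ∞ (fun p : ℝ × ℝ => ξ p.2 + p.1 • δξ p.2) (0, t) :=
    fun t ht => contDiffAt_affineFamily (hξ t ht) (hδξ t ht)
  have hA : ∀ t ∈ Icc t₁ t₂, ContDiffAt ℝ ∞ (fun p : ℝ × ℝ => a p.2 + p.1 • δa p.2) (0, t) :=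
    fun t ht => contDiffAt_affineFamily (ha t ht) (hδa t ht)
  have k1 := h η (fun ε t => ξ t + ε • δξ t) (fun ε t => a t + ε • δa t)
    (fun t _ => hη.contDiffAt) hη₁ hη₂ hΞ hA (fun t _ => by simp) (fun t _ => by simp)
    (fun t _ => hasDerivAt_affineFamily _ _) (fun t _ => hasDerivAt_affineFamily _ _)
  have k2 := hasDerivAt_integral_constrained (ρ := ρ) (Ξ := fun ε t => ξ t + ε • δξ t)
    (A := fun ε t => a t + ε • δa t) hl hξ ha ht
    (fun t _ => hη.contDiffAt) hη₁ hη₂ hΞ hA (fun t _ => by simp) (fun t _ => by simp)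
    (fun t _ => hasDerivAt_affineFamily _ _) (fun t _ => hasDerivAt_affineFamily _ _)
  have k3 := k1.unique k2
  rw [eq_comm, neg_eq_zero] at k3
  exact k3

/-- The advected quantity is the unique solution of the advection equation. -/
theorem advection_iff_eqOn
    (hρ : ContMDiff 𝓘(ℝ, E) 𝓘(ℝ, V →L[ℝ] V) ∞ (fun g : G => ρ (MulOpposite.op g)))
    (a₀ : StrongDual ℝ V) {g : ℝ → G} {t₁ t₂ t₀ : ℝ} (ht₀ : t₀ ∈ Icc t₁ t₂)
    (hg : ∀ t ∈ Icc t₁ t₂, ContMDiffAt 𝓘(ℝ, ℝ) 𝓘(ℝ, E) ∞ g t) (b : ℝ → StrongDual ℝ V) :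
    ((∀ t ∈ Icc t₁ t₂, HasDerivWithinAt b
        (-(dualInfAct ρ (b t) (rightVelocity (E := E) g t))) (Icc t₁ t₂) t) ∧
      b t₀ = dualAct ρ a₀ (g t₀)⁻¹) ↔ EqOn b (advected ρ a₀ g) (Icc t₁ t₂) := by
  have hadv : ∀ t ∈ Icc t₁ t₂, HasDerivWithinAt (advected ρ a₀ g)
      (-(dualInfAct ρ (advected ρ a₀ g t) (rightVelocity (E := E) g t))) (Icc t₁ t₂) t :=
    fun t ht => (hasDerivAt_advected hρ a₀
      ((hg t ht).mdifferentiableAt (by simp))).hasDerivWithinAt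
  constructor
  · rintro ⟨hb, hb0⟩
    -- The advection equation as a linear ODE: `T t` is composition with the action of ξ(t) on V,
    -- norm continuous in t.
    set T : ℝ → StrongDual ℝ V →L[ℝ] StrongDual ℝ V := fun t =>
      (ContinuousLinearMap.compL ℝ V V ℝ).flip (infActCLM ρ (rightVelocity (E := E) g t)) with hT
    have hTa : ∀ t c, T t c = -(dualInfAct ρ c (rightVelocity (E := E) g t)) := fun t c => by
      simp [hT, dualInfAct_eq]
    have hTc : ContinuousOn T (Icc t₁ t₂) := fun t ht => by
      have h1 : ContinuousAt (rightVelocity (E := E) g) t :=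
        (contDiffAt_rightVelocity (hg t ht)).continuousAt
      exact ((((ContinuousLinearMap.compL ℝ V V ℝ).flip.continuous.comp
        (infActCLM ρ).continuous).continuousAt).comp h1).continuousWithinAt
    simp only [← hTa] at hb hadv
    exact eqOn_Icc_of_linearODE hTc ht₀ hb hadv hb0
  · intro h
    refine ⟨fun t ht => ?_, h ht₀⟩
    rw [h ht]
    exact (hadv t ht).congr h (h ht)

end Equivalences

end EulerPoincare

end

theorem theorem3p2
    {E : Type*} [NormedAddCommGroup E] [NormedSpace ℝ E] [CompleteSpace E]
    {G : Type*} [TopologicalSpace G] [ChartedSpace E G] [Group G] [LieGroup 𝓘(ℝ, E) ∞ G]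
    {V : Type*} [NormedAddCommGroup V] [NormedSpace ℝ V] [CompleteSpace V]
    (ρ : Gᵐᵒᵖ →* (V →L[ℝ] V))
    (hρ : ContMDiff 𝓘(ℝ, E) 𝓘(ℝ, V →L[ℝ] V) ∞ (fun g : G => ρ (MulOpposite.op g)))
    (L : TangentBundle 𝓘(ℝ, E) G × StrongDual ℝ V → ℝ)
    (hL : ContMDiff (𝓘(ℝ, E).tangent.prod 𝓘(ℝ, StrongDual ℝ V)) 𝓘(ℝ, ℝ) ∞ L)
    (hinv : RightInvariant ρ L)
    (a₀ : StrongDual ℝ V)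
    (t₁ t₂ : ℝ) (ht : t₁ < t₂)
    (g : ℝ → G) (hg : ∀ t ∈ Set.Icc t₁ t₂, ContMDiffAt 𝓘(ℝ, ℝ) 𝓘(ℝ, E) ∞ g t) :
    (∀ t₀ ∈ Set.Icc t₁ t₂, ∀ b : ℝ → StrongDual ℝ V,
      ((∀ t ∈ Set.Icc t₁ t₂,
          HasDerivWithinAt b (-(dualInfAct ρ (b t) (rightVelocity (E := E) g t)))
            (Set.Icc t₁ t₂) t) ∧
        b t₀ = dualAct ρ a₀ (g t₀)⁻¹) ↔
      Set.EqOn b (advected ρ a₀ g) (Set.Icc t₁ t₂)) ∧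
    List.TFAE [
      HamiltonPrinciple (fun v : TangentBundle 𝓘(ℝ, E) G => L (v, a₀)) g t₁ t₂,
      EulerLagrange (fun v : TangentBundle 𝓘(ℝ, E) G => L (v, a₀)) g t₁ t₂,
      ConstrainedPrinciple ρ (reduced L) (rightVelocity g) (advected ρ a₀ g) t₁ t₂,
      EulerPoincareEquations ρ (reduced L) (rightVelocity g) (advected ρ a₀ g) t₁ t₂] := by
  refine ⟨fun t₀ ht₀ b => advection_iff_eqOn hρ a₀ ht₀ hg b, ?_⟩
  have h1 := hamiltonPrinciple_iff hρ hL hinv a₀ ht hg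
  have h2 := eulerLagrange_iff hρ hL hinv a₀ hg
  have h3 := constrainedPrinciple_iff (ρ := ρ) (contDiff_reduced hL) ht
    (fun t ht => contDiffAt_rightVelocity (hg t ht))
    (fun t ht => contDiffAt_advected hρ a₀ (hg t ht))
  tfae_have 1 ↔ 4 := h1
  tfae_have 2 ↔ 4 := h2
  tfae_have 3 ↔ 4 := h3
  tfae_finish
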